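/- A Pisot number is a real algebraic integer $\theta>1$ all of whose other Galois conjugates have modulus $<1$. For a finite set $A\subset\mathbb Z$ and $\theta\in(1,2)$ put $$S_A(\theta)=\bigcup_{n\ge1}\Big\{\sum_{k=1}^n a_k\theta^k \;\Big|\; a_k\in A\Big\}.$$ **Theorem (Feng).** Let $\theta\in(1,2)$ be a real number. (i) The set $S_{\{0,1\}}(\theta)$ can be listed as a strictly increasing sequence $y_0(\theta)<y_1(\theta)<y_2(\theta)<\cdots$, and $\ell(\theta)=\liminf_{n\to\infty}\,(y_{n+1}(\theta)-y_n(\theta))$ satisfies: $\ell(\theta)>0$ if and only if $\theta$ is Pisot. (ii) The same holds for the digits $-1,0,1$: with $E=S_{\{-1,0,1\}}(\theta)$ and $$\ell^{\pm}(\theta)=\liminf_{x\to+\infty,\;x\in E}\ \inf\{\,y-x : y\in E,\ y>x\,\}$$ (the lower limit of the gaps of $E$, which is meaningful also when $E$ is dense), one has $\ell^{\pm}(\theta)>0$ if and only if $\theta$ is Pisot. -/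

import Mathlib

open Filter Set

/-- A Pisot number: a real algebraic integer `θ > 1` all of whose other Galois conjugates
(the complex roots, other than `θ`, of its minimal polynomial over `ℚ`) have modulus `< 1`. -/
def IsPisot (θ : ℝ) : Prop :=
  1 < θ ∧ IsIntegral ℤ θ ∧ ∀ z ∈ (minpoly ℚ θ).aroots ℂ, z ≠ (θ : ℂ) → ‖z‖ < 1

/-- The set of all sums `∑_{k=1}^n a_k θ^k`, `n ≥ 1`, with digits `a_k` in `A`. -/
def digitSums (A : Set ℤ) (θ : ℝ) : Set ℝ :=
  {x | ∃ n : ℕ, 1 ≤ n ∧ ∃ a : ℕ → ℤ, (∀ k, a k ∈ A) ∧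
    x = ∑ k ∈ Finset.Icc 1 n, (a k : ℝ) * θ ^ k}

/-- The lower limit, as `x → +∞` inside `E`, of the gap `inf {y - x | y ∈ E, y > x}` between `x`
and the part of `E` to the right of `x`. It makes sense for every `E ⊆ ℝ`; it is `0` if `E` is
dense, and if `E` is listed by an increasing sequence tending to infinity then it is the lower
limit of the consecutive gaps (`gapLiminf_range` below). -/
noncomputable def gapLiminf (E : Set ℝ) : EReal :=
  liminf (fun x : ℝ => ⨅ y ∈ E ∩ Ioi x, ((y - x : ℝ) : EReal)) (atTop ⊓ 𝓟 E)

theorem gapLiminf_range (y : ℕ → ℝ) (hy : StrictMono y) (hlim : Tendsto y atTop atTop) :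
    gapLiminf (range y) = liminf (fun n => ((y (n + 1) - y n : ℝ) : EReal)) atTop := by
  have hmap : atTop ⊓ 𝓟 (range y) = map y atTop := by
    apply le_antisymm
    · intro s hs
      obtain ⟨N, hN⟩ := mem_atTop_sets.1 (mem_map.1 hs)
      rw [mem_inf_principal]
      filter_upwards [eventually_ge_atTop (y N)] with x hx
      rintro ⟨n, rfl⟩
      exact hN n (hy.le_iff_le.1 hx)
    · exact le_inf hlim (le_principal_iff.2 (range_mem_map))
  have hgap : ∀ n, (⨅ z ∈ range y ∩ Ioi (y n), ((z - y n : ℝ) : EReal)) =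
      ((y (n + 1) - y n : ℝ) : EReal) := by
    intro n
    apply le_antisymm
    · exact iInf₂_le (y (n + 1)) ⟨mem_range_self _, hy n.lt_succ_self⟩
    · refine le_iInf₂ ?_
      rintro _ ⟨⟨m, rfl⟩, hm⟩
      have : y (n + 1) ≤ y m := hy.monotone (hy.lt_iff_lt.1 hm)
      exact_mod_cast sub_le_sub_right this _
  unfold gapLiminf
  rw [hmap, ← liminf_comp]
  exact congrArg (fun f => liminf f atTop) (funext hgap)

/-! Write I for `maxSum θ` = θ/(θ-1). A sum with digits -1, 0, 1 is a difference of two sums with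
digits 0, 1, and adding a high power of θ to both moves them far to the right. So a positive lower
limit of the gaps, for either digit set, keeps the nonzero sums with digits -1, 0, 1 away from 0
(`exists_le_abs_of_gapLiminf_pos`). Conversely, in a Pisot base Garsia's norm argument separates all
sums with bounded digits (`IsPisot.exists_le_abs`). The core is that separation implies Pisot
(`isPisot_of_separated`).

Separation bounds the number of level-n sums in a window of length I. A window with the maximal
number cannot gain points under translation, and this leaves only finitely many sums with digits -1,
0, 1 in [-I/2, I/2] (`finite_allSums_inter_of_separated`). By pigeonhole, two monic integer
polynomials of different degrees agree at θ, so θ is an algebraic integer.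

Let p ≠ θ be a conjugate with |p| ≥ 1, and pair each sum t with its conjugate u. Finiteness makes u
bounded for |t| ≤ I. It follows that 1 is the only sum in (0, I/2]: if |p| > 1, greedy expansions
evaluated in base p give a bounded function turning translation by t into translation by u, so u is
proportional to t in a range, too rigid for p ≠ θ (`IsConjOf.eq_one_of_one_lt_norm`); if |p| = 1,
digits whose contributions in a fixed direction are nonnegative must lead to 0, and using two
opposite directions kills all contributions (`IsConjOf.eq_one_of_norm_eq_one`). But then θ and p
satisfy x^m (2 - x) = 1 for some m ≥ 1, whose roots other than 1 and θ lie in the open unit disc: a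
contradiction. -/

open Topology

/-! ### Digit sums by levels -/

/-- The sums of `n` digits: `levelSums A θ n = {∑_{k=1}^n a_k θ^k | a_k ∈ A}`, in Horner form. -/
def levelSums {R : Type*} [Ring R] (A : Set ℤ) (θ : R) : ℕ → Set R
  | 0 => {0}
  | n + 1 => {x | ∃ y ∈ levelSums A θ n, ∃ a ∈ A, x = θ * (y + (a : R))}

/-- The union of all levels `levelSums A θ n`. -/
def allSums {R : Type*} [Ring R] (A : Set ℤ) (θ : R) : Set R := ⋃ n, levelSums A θ n

section levels

variable {R : Type*} [Ring R] {A : Set ℤ} {θ : R}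

theorem mem_allSums {x : R} : x ∈ allSums A θ ↔ ∃ n, x ∈ levelSums A θ n := mem_iUnion

theorem zero_mem_allSums : (0 : R) ∈ allSums A θ := mem_allSums.2 ⟨0, rfl⟩

theorem step_mem_levelSums {n : ℕ} {x : R} (hx : x ∈ levelSums A θ n) {a : ℤ} (ha : a ∈ A) :
    θ * (x + a) ∈ levelSums A θ (n + 1) := ⟨x, hx, a, ha, rfl⟩

theorem step_mem_allSums {x : R} (hx : x ∈ allSums A θ) {a : ℤ} (ha : a ∈ A) :
    θ * (x + a) ∈ allSums A θ := by
  obtain ⟨n, hn⟩ := mem_allSums.1 hx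
  exact mem_allSums.2 ⟨n + 1, step_mem_levelSums hn ha⟩

theorem levelSums_mono (h0 : 0 ∈ A) : Monotone (levelSums A θ) := by
  refine monotone_nat_of_le_succ fun n => ?_
  induction n with
  | zero => rintro x rfl; exact ⟨0, rfl, 0, h0, by simp⟩
  | succ n ih => rintro _ ⟨y, hy, a, ha, rfl⟩; exact step_mem_levelSums (ih hy) ha

theorem levelSums_subset {B : Set ℤ} (h : A ⊆ B) (n : ℕ) :
    levelSums A θ n ⊆ levelSums B θ n := by
  induction n with
  | zero => exact Subset.rfl
  | succ n ih => rintro _ ⟨y, hy, a, ha, rfl⟩; exact ⟨y, ih hy, a, h ha, rfl⟩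

theorem levelSums_finite (hA : A.Finite) (n : ℕ) : (levelSums A θ n).Finite := by
  induction n with
  | zero => exact finite_singleton 0
  | succ n ih =>
    refine (Finite.image2 (fun y (a : ℤ) => θ * (y + (a : R))) ih hA).subset ?_
    rintro _ ⟨y, hy, a, ha, rfl⟩
    exact ⟨y, hy, a, ha, rfl⟩

theorem levelSums_sub {B C : Set ℤ} (h : ∀ a ∈ A, ∀ b ∈ B, a - b ∈ C) {n : ℕ} {x y : R}
    (hx : x ∈ levelSums A θ n) (hy : y ∈ levelSums B θ n) : x - y ∈ levelSums C θ n := by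
  induction n generalizing x y with
  | zero => rw [mem_singleton_iff.1 hx, mem_singleton_iff.1 hy, sub_zero]; rfl
  | succ n ih =>
    obtain ⟨x, hx, a, ha, rfl⟩ := hx
    obtain ⟨y, hy, b, hb, rfl⟩ := hy
    refine ⟨x - y, ih hx hy, a - b, h a ha b hb, ?_⟩
    push_cast
    rw [← mul_sub]
    congr 1
    abel

theorem exists_sub_of_mem_levelSums {n : ℕ} {t : R} (ht : t ∈ levelSums {-1, 0, 1} θ n) :
    ∃ x ∈ levelSums {0, 1} θ n, ∃ y ∈ levelSums {0, 1} θ n, t = x - y := by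
  induction n generalizing t with
  | zero => exact ⟨0, rfl, 0, rfl, by rw [mem_singleton_iff.1 ht, sub_zero]⟩
  | succ n ih =>
    obtain ⟨t, ht, e, he, rfl⟩ := ht
    obtain ⟨x, hx, y, hy, rfl⟩ := ih ht
    have : ∃ a ∈ ({0, 1} : Set ℤ), ∃ b ∈ ({0, 1} : Set ℤ), e = a - b := by
      rcases he with rfl | rfl | rfl
      · exact ⟨0, by simp, 1, by simp, by simp⟩
      · exact ⟨0, by simp, 0, by simp, by simp⟩
      · exact ⟨1, by simp, 0, by simp, by simp⟩
    obtain ⟨a, ha, b, hb, rfl⟩ := this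
    refine ⟨_, step_mem_levelSums hx ha, _, step_mem_levelSums hy hb, ?_⟩
    push_cast
    rw [← mul_sub]
    congr 1
    abel

theorem neg_mem_levelSums {n : ℕ} {t : R} (ht : t ∈ levelSums {-1, 0, 1} θ n) :
    -t ∈ levelSums {-1, 0, 1} θ n := by
  obtain ⟨x, hx, y, hy, rfl⟩ := exists_sub_of_mem_levelSums ht
  rw [neg_sub]
  refine levelSums_sub (A := {0, 1}) (B := {0, 1}) ?_ hy hx
  rintro a (rfl | rfl) b (rfl | rfl) <;> simp

theorem neg_mem_allSums {t : R} (ht : t ∈ allSums {-1, 0, 1} θ) :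
    -t ∈ allSums {-1, 0, 1} θ := by
  obtain ⟨n, hn⟩ := mem_allSums.1 ht
  exact mem_allSums.2 ⟨n, neg_mem_levelSums hn⟩

end levels

section comm

variable {R : Type*} [CommRing R] {A : Set ℤ} {θ : R}

theorem pow_mul_add_mem_levelSums {m n : ℕ} {x y : R} (hx : x ∈ levelSums A θ m)
    (hy : y ∈ levelSums A θ n) : θ ^ n * x + y ∈ levelSums A θ (m + n) := by
  induction n generalizing y with
  | zero => rw [mem_singleton_iff.1 hy]; simpa using hx
  | succ n ih =>
    obtain ⟨y, hy, a, ha, rfl⟩ := hy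
    exact ⟨_, ih hy, a, ha, by ring⟩

theorem mem_levelSums_iff_exists_sum {n : ℕ} {x : R} (h : A.Nonempty) :
    x ∈ levelSums A θ n ↔ ∃ a : ℕ → ℤ, (∀ k, a k ∈ A) ∧
      x = ∑ k ∈ Finset.Icc 1 n, (a k : R) * θ ^ k := by
  induction n generalizing x with
  | zero =>
    obtain ⟨c, hc⟩ := h
    simpa [levelSums] using fun _ => ⟨fun _ => c, fun _ => hc⟩
  | succ n ih =>
    have key : ∀ f : ℕ → R, ∑ k ∈ Finset.Icc 1 (n + 1), f k * θ ^ k =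
        θ * (∑ k ∈ Finset.Icc 1 n, f (k + 1) * θ ^ k + f 1) := by
      intro f
      rw [← Finset.Ico_add_one_right_eq_Icc, ← Finset.Ico_add_one_right_eq_Icc,
        Finset.sum_Ico_eq_sum_range, Finset.sum_Ico_eq_sum_range]
      simp only [Nat.add_sub_cancel]
      rw [Finset.sum_range_succ', mul_add, Finset.mul_sum]
      congr 1
      · refine Finset.sum_congr rfl fun k _ => ?_
        rw [show 1 + (k + 1) = (1 + k) + 1 by ring]; ring
      · ring
    constructor
    · rintro ⟨y, hy, c, hc, rfl⟩
      obtain ⟨a, ha, rfl⟩ := ih.1 hy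
      refine ⟨fun k => if k ≤ 1 then c else a (k - 1), fun k => ?_, ?_⟩
      · dsimp only; split_ifs
        exacts [hc, ha _]
      · rw [key]
        simp only [le_refl, if_true]
        congr 2
        refine Finset.sum_congr rfl fun k hk => ?_
        have := (Finset.mem_Icc.1 hk).1
        rw [if_neg (by omega), Nat.add_sub_cancel]
    · rintro ⟨a, ha, rfl⟩
      rw [key]
      exact ⟨_, ih.2 ⟨fun k => a (k + 1), fun k => ha _, rfl⟩, a 1, ha 1, rfl⟩

end comm

theorem digitSums_eq_allSums {A : Set ℤ} (h0 : 0 ∈ A) (θ : ℝ) :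
    digitSums A θ = allSums A θ := by
  ext x
  rw [mem_allSums]
  constructor
  · rintro ⟨n, -, hn⟩
    exact ⟨n, (mem_levelSums_iff_exists_sum ⟨0, h0⟩).2 hn⟩
  · rintro ⟨n, hn⟩
    exact ⟨n + 1, by omega, (mem_levelSums_iff_exists_sum ⟨0, h0⟩).1
      (levelSums_mono h0 n.le_succ hn)⟩

/-! ### Gap limits and enumeration of locally finite sets -/

theorem le_gapLiminf {E : Set ℝ} {δ : ℝ} (h : ∀ x ∈ E, ∀ y ∈ E, x < y → δ ≤ y - x) :
    (δ : EReal) ≤ gapLiminf E := by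
  refine le_liminf_of_le (by isBoundedDefault) ?_
  filter_upwards [mem_inf_of_right (mem_principal_self E)] with x hx
  exact le_iInf₂ fun y hy => EReal.coe_le_coe_iff.2 (h x hx y hy.1 hy.2)

theorem gapLiminf_le {E : Set ℝ} {δ : ℝ}
    (h : ∀ M : ℝ, ∃ x ∈ E, M ≤ x ∧ ∃ y ∈ E, x < y ∧ y - x ≤ δ) : gapLiminf E ≤ δ := by
  refine liminf_le_of_frequently_le ?_ (by isBoundedDefault)
  rw [frequently_inf_principal, frequently_atTop]
  intro M
  obtain ⟨x, hx, hM, y, hy, hxy, hd⟩ := h M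
  exact ⟨x, hM, hx, (iInf₂_le y ⟨hy, hxy⟩).trans (EReal.coe_le_coe_iff.2 hd)⟩

/-- A set of reals that is unbounded above, bounded below and locally finite is listed by a strictly
increasing sequence. -/
theorem exists_strictMono_range_eq {X : Set ℝ} (hne : X.Nonempty)
    (hfin : ∀ M : ℝ, (X ∩ Iic M).Finite) (hub : ∀ M : ℝ, ∃ x ∈ X, M < x) :
    ∃ y : ℕ → ℝ, StrictMono y ∧ range y = X ∧ Tendsto y atTop atTop := by
  have hmin : ∀ M : ℝ, ∃ x ∈ X, M < x ∧ ∀ z ∈ X, M < z → x ≤ z := by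
    intro M
    obtain ⟨x₀, hx₀, hM⟩ := hub M
    obtain ⟨x, hx, hmin⟩ := ((hfin x₀).subset (inter_subset_inter_right X
      (fun z (hz : z ∈ Ioc M x₀) => hz.2))).exists_minimal ⟨x₀, hx₀, hM, le_rfl⟩
    refine ⟨x, hx.1, hx.2.1, fun z hz hMz => ?_⟩
    rcases le_total z x₀ with h | h
    · rcases le_total z x with h' | h'
      · exact hmin ⟨hz, hMz, h⟩ h'
      · exact h'
    · exact hx.2.2.trans h
  choose s hsX hsM hsmin using hmin
  obtain ⟨z₀, hz₀⟩ := hne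
  obtain ⟨x₀, hx₀, hx₀min⟩ := (hfin z₀).exists_minimal ⟨z₀, hz₀, mem_Iic.2 le_rfl⟩
  have hleast : ∀ z ∈ X, x₀ ≤ z := by
    intro z hz
    rcases le_total z x₀ with h | h
    · exact hx₀min ⟨hz, h.trans (mem_Iic.1 hx₀.2)⟩ h
    · exact h
  let y : ℕ → ℝ := fun n => s^[n] x₀
  have hy0 : y 0 = x₀ := rfl
  have hys : ∀ n, y (n + 1) = s (y n) := fun n => Function.iterate_succ_apply' s n x₀
  have hyX : ∀ n, y n ∈ X := by
    intro n
    cases n with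
    | zero => exact hx₀.1
    | succ n => rw [hys]; exact hsX _
  have hmono : StrictMono y := strictMono_nat_of_lt_succ fun n => by rw [hys]; exact hsM _
  have hlim : Tendsto y atTop atTop := by
    refine tendsto_atTop_atTop_of_monotone hmono.monotone fun M => ?_
    by_contra hcon
    push Not at hcon
    exact infinite_range_of_injective hmono.injective
      ((hfin M).subset (range_subset_iff.2 fun n => ⟨hyX n, (hcon n).le⟩))
  refine ⟨y, hmono, Subset.antisymm (range_subset_iff.2 hyX) fun z hz => ?_, hlim⟩
  obtain ⟨n, hn⟩ := (hlim.eventually_gt_atTop z).exists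
  by_contra hz'
  have : ∀ k, y k < z := by
    intro k
    induction k with
    | zero => exact lt_of_le_of_ne (hleast z hz) fun h => hz' ⟨0, h⟩
    | succ k ih =>
      refine lt_of_le_of_ne ?_ fun h => hz' ⟨k + 1, h⟩
      rw [hys]
      exact hsmin _ z hz ih
  exact (this n).not_gt hn

/-! ### Conjugate sums and Garsia's lemma -/

section hom

variable {R S : Type*} [Ring R] [Ring S] {A : Set ℤ} {θ : R} {n : ℕ}

theorem map_mem_levelSums (f : R →+* S) {x : R} (hx : x ∈ levelSums A θ n) :
    f x ∈ levelSums A (f θ) n := by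
  induction n generalizing x with
  | zero => rw [mem_singleton_iff.1 hx, map_zero]; rfl
  | succ n ih =>
    obtain ⟨y, hy, a, ha, rfl⟩ := hx
    exact ⟨f y, ih hy, a, ha, by simp⟩

theorem exists_map_eq_of_mem_levelSums (f : R →+* S) {x : S} (hx : x ∈ levelSums A (f θ) n) :
    ∃ y ∈ levelSums A θ n, f y = x := by
  induction n generalizing x with
  | zero => exact ⟨0, rfl, by rw [mem_singleton_iff.1 hx, map_zero]⟩
  | succ n ih =>
    obtain ⟨x, hx, a, ha, rfl⟩ := hx
    obtain ⟨y, hy, rfl⟩ := ih hx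
    exact ⟨_, step_mem_levelSums hy ha, by simp⟩

end hom

theorem isIntegral_of_mem_levelSums {R : Type*} [CommRing R] {A : Set ℤ} {θ : R} {n : ℕ}
    (h : IsIntegral ℤ θ) {x : R} (hx : x ∈ levelSums A θ n) : IsIntegral ℤ x := by
  induction n generalizing x with
  | zero => rw [mem_singleton_iff.1 hx]; exact isIntegral_zero
  | succ n ih =>
    obtain ⟨y, hy, a, -, rfl⟩ := hx
    exact h.mul ((ih hy).add (isIntegral_algebraMap (R := ℤ) (x := a)))

theorem norm_le_of_mem_levelSums {z : ℂ} (hz : ‖z‖ < 1) {m : ℝ} {n : ℕ} {x : ℂ}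
    (hx : x ∈ levelSums {a | |(a : ℝ)| ≤ m} z n) : ‖x‖ ≤ |m| / (1 - ‖z‖) := by
  have h1 : 0 < 1 - ‖z‖ := by linarith
  induction n generalizing x with
  | zero => rw [mem_singleton_iff.1 hx, norm_zero]; positivity
  | succ n ih =>
    obtain ⟨y, hy, a, ha, rfl⟩ := hx
    have ha' : ‖(a : ℂ)‖ ≤ |m| := by
      rw [Complex.norm_intCast]; exact le_trans ha (le_abs_self m)
    have hB : |m| / (1 - ‖z‖) * (1 - ‖z‖) = |m| := div_mul_cancel₀ _ h1.ne'
    calc ‖z * (y + a)‖ = ‖z‖ * ‖y + a‖ := norm_mul _ _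
      _ ≤ ‖z‖ * (|m| / (1 - ‖z‖) + |m|) := by
          gcongr; exact (norm_add_le _ _).trans (add_le_add (ih hy) ha')
      _ ≤ |m| / (1 - ‖z‖) := by nlinarith [abs_nonneg m, norm_nonneg z]

/-- Garsia's separation lemma: sums with bounded integer digits in a Pisot base are `0` or bounded
away from `0`. -/
theorem IsPisot.exists_le_abs {θ : ℝ} (h : IsPisot θ) (m : ℝ) :
    ∃ δ > 0, ∀ t ∈ allSums {a | |(a : ℝ)| ≤ m} θ, t ≠ 0 → δ ≤ |t| := by
  obtain ⟨-, hint, hconj⟩ := h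
  have hintQ : IsIntegral ℚ θ := hint.tower_top
  let K := IntermediateField.adjoin ℚ {θ}
  let α : K := IntermediateField.AdjoinSimple.gen ℚ θ
  have hα : algebraMap K ℝ α = θ := IntermediateField.AdjoinSimple.algebraMap_gen ℚ θ
  have hαint : IsIntegral ℤ α := by
    rw [← isIntegral_algebraMap_iff (algebraMap K ℝ).injective, hα]; exact hint
  have : FiniteDimensional ℚ K := IntermediateField.adjoin.finiteDimensional hintQ
  let σ₀ : K →ₐ[ℚ] ℂ := (Complex.ofRealAm.restrictScalars ℚ).comp K.val
  have hσ₀ : ∀ x : K, σ₀ x = ((algebraMap K ℝ x : ℝ) : ℂ) := fun x => rfl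
  classical
  -- An embedding is determined by the image of the generator, so only σ₀ sends it to θ.
  have hσ : ∀ σ : K →ₐ[ℚ] ℂ, σ ≠ σ₀ → ‖σ α‖ < 1 := by
    intro σ hne
    refine hconj _ ?_ fun hcon => hne ?_
    · rw [Polynomial.mem_aroots]
      refine ⟨minpoly.ne_zero hintQ, ?_⟩
      rw [← IntermediateField.minpoly_gen ℚ θ, Polynomial.aeval_algHom_apply]
      exact (congrArg σ (minpoly.aeval ℚ α)).trans (map_zero σ)
    · refine (IntermediateField.adjoin.powerBasis hintQ).algHom_ext ?_
      rw [IntermediateField.adjoin.powerBasis_gen]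
      change σ α = σ₀ α
      rw [hcon, hσ₀, hα]
  -- The `+ 1` keeps the bound positive when `m = 0`.
  let B : (K →ₐ[ℚ] ℂ) → ℝ := fun σ => |m| / (1 - ‖σ α‖) + 1
  have hB : ∀ σ ∈ Finset.univ.erase σ₀, 0 < B σ := by
    intro σ hs
    have := hσ σ (Finset.ne_of_mem_erase hs)
    have : 0 ≤ |m| / (1 - ‖σ α‖) := div_nonneg (abs_nonneg m) (by linarith)
    simp only [B]; linarith
  have hprod : 0 < ∏ σ ∈ Finset.univ.erase σ₀, B σ := Finset.prod_pos hB
  refine ⟨(∏ σ ∈ Finset.univ.erase σ₀, B σ)⁻¹, inv_pos.2 hprod, fun t ht ht0 => ?_⟩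
  obtain ⟨n, hn⟩ := mem_allSums.1 ht
  rw [← hα] at hn
  obtain ⟨x, hx, rfl⟩ := exists_map_eq_of_mem_levelSums (algebraMap K ℝ) hn
  have hx0 : x ≠ 0 := fun h => ht0 (by rw [h, map_zero])
  -- The norm of x is a nonzero integer, so the product of all its conjugates has modulus at least
  -- 1; every factor except x itself is at most `B σ`.
  obtain ⟨k, hk⟩ := IsIntegrallyClosed.isIntegral_iff.1
    (Algebra.isIntegral_norm ℚ (isIntegral_of_mem_levelSums hαint hx))
  have hk0 : k ≠ 0 := by
    rintro rfl
    exact hx0 (Algebra.norm_eq_zero_iff.1 (by rw [← hk, map_zero]))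
  have hnorm := Algebra.norm_eq_prod_embeddings ℚ ℂ (L := K) x
  rw [← hk, ← Finset.mul_prod_erase _ _ (Finset.mem_univ σ₀)] at hnorm
  have hle : (1 : ℝ) ≤ |algebraMap K ℝ x| * ∏ σ ∈ Finset.univ.erase σ₀, B σ := by
    calc (1 : ℝ) ≤ ‖(k : ℂ)‖ := by
          rw [Complex.norm_intCast]; exact_mod_cast Int.one_le_abs hk0
      _ = ‖σ₀ x‖ * ∏ σ ∈ Finset.univ.erase σ₀, ‖σ x‖ := by
          rw [← norm_prod, ← norm_mul, ← hnorm]; simp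
      _ ≤ _ := by
          rw [hσ₀, Complex.norm_real, Real.norm_eq_abs]
          refine mul_le_mul_of_nonneg_left (Finset.prod_le_prod (fun _ _ => norm_nonneg _) ?_)
            (abs_nonneg _)
          intro σ hs
          have := norm_le_of_mem_levelSums (hσ σ (Finset.ne_of_mem_erase hs))
            (map_mem_levelSums (σ : K →+* ℂ) hx)
          exact this.trans (by simp [B])
  rwa [inv_le_iff_one_le_mul₀ hprod]

/-! ### Gaps of the spectrum versus separation from 0 -/

section real

variable {A : Set ℤ} {θ : ℝ}

theorem nonneg_of_mem_levelSums (hθ : 0 ≤ θ) {n : ℕ} {x : ℝ} (hx : x ∈ levelSums {0, 1} θ n) :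
    0 ≤ x := by
  induction n generalizing x with
  | zero => rw [mem_singleton_iff.1 hx]
  | succ n ih =>
    obtain ⟨y, hy, a, ha, rfl⟩ := hx
    have : (0 : ℝ) ≤ a := by rcases ha with rfl | rfl <;> simp
    exact mul_nonneg hθ (add_nonneg (ih hy) this)

theorem pow_mem_levelSums (hA : {0, 1} ⊆ A) (n : ℕ) : θ ^ (n + 1) ∈ levelSums A θ (n + 1) := by
  induction n with
  | zero => exact ⟨0, rfl, 1, hA (by simp), by simp⟩
  | succ n ih => exact ⟨_, ih, 0, hA (by simp), by rw [pow_succ']; simp⟩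

/-- If the gaps of a spectrum have a positive lower limit, then the sums with digits `-1, 0, 1` are
`0` or bounded away from `0`. -/
theorem exists_le_abs_of_gapLiminf_pos (hθ : 1 < θ) (hA : {0, 1} ⊆ A)
    (h : 0 < gapLiminf (allSums A θ)) :
    ∃ δ > 0, ∀ t ∈ allSums {-1, 0, 1} θ, t ≠ 0 → δ ≤ |t| := by
  obtain ⟨δ, hδ0, hδ⟩ := EReal.lt_iff_exists_real_btwn.1 h
  refine ⟨δ, by exact_mod_cast hδ0, ?_⟩
  by_contra! hcon
  obtain ⟨t, ht, ht0, htδ⟩ := hcon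
  obtain ⟨t, ht, ht0, htδ⟩ : ∃ t ∈ allSums {-1, 0, 1} θ, 0 < t ∧ t < δ := by
    rcases ht0.lt_or_gt with h | h
    · exact ⟨-t, neg_mem_allSums ht, by linarith, by rwa [abs_of_neg h] at htδ⟩
    · exact ⟨t, ht, h, by rwa [abs_of_pos h] at htδ⟩
  obtain ⟨n, hn⟩ := mem_allSums.1 ht
  obtain ⟨x, hx, y, hy, rfl⟩ := exists_sub_of_mem_levelSums hn
  refine hδ.not_ge (gapLiminf_le fun M => ?_)
  obtain ⟨k, hk⟩ := pow_unbounded_of_one_lt M hθ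
  have hz := pow_mem_levelSums (θ := θ) hA k
  -- A leading digit 1 placed above the n digits of x and y shifts both without changing their
  -- difference.
  refine ⟨θ ^ n * θ ^ (k + 1) + y,
    mem_allSums.2 ⟨_, pow_mul_add_mem_levelSums hz (levelSums_subset hA n hy)⟩, ?_,
    θ ^ n * θ ^ (k + 1) + x,
    mem_allSums.2 ⟨_, pow_mul_add_mem_levelSums hz (levelSums_subset hA n hx)⟩,
    by linarith, by linarith⟩
  have h1 : θ ^ k ≤ θ ^ n * θ ^ (k + 1) := by
    rw [← pow_add]; exact pow_le_pow_right₀ hθ.le (by omega)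
  linarith [nonneg_of_mem_levelSums (zero_le_one.trans hθ.le) hy]

theorem IsPisot.gapLiminf_pos (h : IsPisot θ) (h0 : 0 ∈ A) {m : ℝ}
    (hA : ∀ a ∈ A, ∀ b ∈ A, |((a - b : ℤ) : ℝ)| ≤ m) : 0 < gapLiminf (allSums A θ) := by
  obtain ⟨δ, hδ, hsep⟩ := h.exists_le_abs m
  refine lt_of_lt_of_le (by exact_mod_cast hδ) (le_gapLiminf (δ := δ) fun x hx y hy hxy => ?_)
  obtain ⟨i, hi⟩ := mem_allSums.1 hx
  obtain ⟨j, hj⟩ := mem_allSums.1 hy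
  have := hsep (y - x) (mem_allSums.2 ⟨max i j, levelSums_sub hA
    (levelSums_mono h0 (le_max_right i j) hj) (levelSums_mono h0 (le_max_left i j) hi)⟩)
    (by linarith)
  rwa [abs_of_pos (by linarith)] at this

theorem allSums_inter_Iic_finite (hθ : 1 < θ) (M : ℝ) : (allSums {0, 1} θ ∩ Iic M).Finite := by
  -- A sum that is new at level n must have top digit 1. At n = 0 the truncated `n - 1` makes the
  -- assumptions contradictory.
  have hlev : ∀ n, ∀ x ∈ levelSums {0, 1} θ n, x ∉ levelSums {0, 1} θ (n - 1) →
      θ ^ n ≤ x := by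
    intro n
    induction n with
    | zero => intro x hx hx'; exact absurd hx hx'
    | succ n ih =>
      rintro _ ⟨y, hy, a, ha, rfl⟩ hx'
      have ha0 : (0 : ℝ) ≤ a := by rcases ha with rfl | rfl <;> simp
      rw [pow_succ']
      refine mul_le_mul_of_nonneg_left ?_ (by linarith)
      rcases n with _ | n
      · rw [mem_singleton_iff.1 hy] at hx' ⊢
        rcases ha with rfl | rfl
        · exact absurd (by simp [levelSums]) hx'
        · simp
      · have := ih y hy fun hy' => hx' ⟨y, hy', a, ha, rfl⟩
        linarith
  obtain ⟨N, hN⟩ := pow_unbounded_of_one_lt M hθ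
  refine (levelSums_finite (R := ℝ) (θ := θ) (toFinite {0, 1}) N).subset ?_
  rintro x ⟨hx, hxM⟩
  obtain ⟨n, hn⟩ := mem_allSums.1 hx
  induction n with
  | zero => exact levelSums_mono (by simp) (Nat.zero_le N) hn
  | succ n ih =>
    by_cases h' : x ∈ levelSums {0, 1} θ n
    · exact ih h'
    · have h1 := hlev _ x hn h'
      rcases le_total (n + 1) N with h2 | h2
      · exact levelSums_mono (by simp) h2 hn
      · have := pow_le_pow_right₀ hθ.le h2
        exact absurd (mem_Iic.1 hxM) (by linarith)

end real

/-! ### Coverings and Feng's finiteness theorem -/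

/-- The largest infinite sum `∑_{k ≥ 0} θ^{-k}` with digits `0, 1` in base `θ`. -/
noncomputable def maxSum (θ : ℝ) : ℝ := θ / (θ - 1)

section

variable {θ : ℝ}

theorem mul_maxSum_sub_one (h1 : 1 < θ) : θ * (maxSum θ - 1) = maxSum θ := by
  have : θ - 1 ≠ 0 := by linarith
  unfold maxSum
  field_simp
  ring

theorem two_lt_maxSum (h1 : 1 < θ) (h2 : θ < 2) : 2 < maxSum θ := by
  rw [maxSum, lt_div_iff₀ (by linarith)]
  linarith

theorem lt_maxSum (h1 : 1 < θ) (h2 : θ < 2) : θ < maxSum θ := h2.trans (two_lt_maxSum h1 h2)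

theorem le_of_mem_levelSums (h1 : 1 < θ) {n : ℕ} {x : ℝ} (hx : x ∈ levelSums {0, 1} θ n) :
    x ≤ θ ^ n * maxSum θ - maxSum θ := by
  induction n generalizing x with
  | zero => rw [mem_singleton_iff.1 hx]; simp
  | succ n ih =>
    obtain ⟨y, hy, a, ha, rfl⟩ := hx
    have ha1 : (a : ℝ) ≤ 1 := by rcases ha with rfl | rfl <;> simp
    have := mul_maxSum_sub_one h1
    calc θ * (y + a) ≤ θ * (θ ^ n * maxSum θ - maxSum θ + 1) := by
          have := ih hy
          gcongr
      _ = _ := by rw [pow_succ]; linear_combination -this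

/-- The set of words of level `n` whose cylinder, rescaled by `θ ^ n`, covers `z`. -/
def covering (θ : ℝ) (n : ℕ) (z : ℝ) : Set ℝ :=
  {y ∈ levelSums {0, 1} θ n | 0 ≤ z - y ∧ z - y ≤ maxSum θ}

/-- Digits are chosen greedily: 1 as soon as the remainder is at least 1. Below 1 the digit 0 is
safe because `θ < maxSum θ`, which is where `θ < 2` enters. -/
theorem covering_nonempty (h1 : 1 < θ) (h2 : θ < 2) {n : ℕ} {z : ℝ} (hz : 0 ≤ z)
    (hz' : z ≤ θ ^ n * maxSum θ) : (covering θ n z).Nonempty := by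
  induction n generalizing z with
  | zero => exact ⟨0, rfl, by simpa using hz, by simpa using hz'⟩
  | succ n ih =>
    have h0 : 0 < θ := by linarith
    obtain ⟨y, hy, hy0, hy1⟩ := ih (z := z / θ) (by positivity)
      (by rw [div_le_iff₀ h0]; linarith [pow_succ θ n ▸ hz'])
    have hI := mul_maxSum_sub_one h1
    have hI2 := lt_maxSum h1 h2
    have hz0 : θ * (z / θ) = z := mul_div_cancel₀ z h0.ne'
    rcases lt_or_ge (z / θ - y) 1 with h | h
    · refine ⟨_, step_mem_levelSums hy (a := 0) (by simp), ?_, ?_⟩ <;> push_cast <;> nlinarith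
    · refine ⟨_, step_mem_levelSums hy (a := 1) (by simp), ?_, ?_⟩ <;> push_cast <;> nlinarith

theorem covering_finite (n : ℕ) (z : ℝ) : (covering θ n z).Finite :=
  (levelSums_finite (toFinite _) n).subset fun _ h => h.1

/-- Distinct elements are at least δ apart, so cutting the window into cells of length δ separates
them. -/
theorem ncard_covering_le {δ : ℝ} (hδ : 0 < δ)
    (hsep : ∀ t ∈ allSums {-1, 0, 1} θ, t ≠ 0 → δ ≤ |t|) (n : ℕ) (z : ℝ) :
    (covering θ n z).ncard ≤ ⌊maxSum θ / δ⌋₊ + 1 := by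
  rw [← Finset.card_range (⌊maxSum θ / δ⌋₊ + 1), ← ncard_coe_finset]
  refine ncard_le_ncard_of_injOn (fun y => ⌊(z - y) / δ⌋₊) ?_ ?_ (Finset.finite_toSet _)
  · intro y hy
    rw [Finset.mem_coe, Finset.mem_range, Nat.lt_succ_iff]
    exact Nat.floor_le_floor (div_le_div_of_nonneg_right hy.2.2 hδ.le)
  · intro x hx y hy hxy
    by_contra hne
    have hmem : x - y ∈ allSums {-1, 0, 1} θ :=
      mem_allSums.2 ⟨n, levelSums_sub (by rintro a (rfl | rfl) b (rfl | rfl) <;> simp) hx.1 hy.1⟩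
    have h := hsep _ hmem (sub_ne_zero.2 hne)
    have hx0 : 0 ≤ (z - x) / δ := div_nonneg hx.2.1 hδ.le
    have hy0 : 0 ≤ (z - y) / δ := div_nonneg hy.2.1 hδ.le
    have hxy' : (⌊(z - x) / δ⌋₊ : ℝ) = ⌊(z - y) / δ⌋₊ := congrArg _ hxy
    have e1 := Nat.floor_le hx0
    have e2 := Nat.lt_floor_add_one ((z - x) / δ)
    have e3 := Nat.floor_le hy0
    have e4 := Nat.lt_floor_add_one ((z - y) / δ)
    have : |(z - y) / δ - (z - x) / δ| < 1 := by rw [abs_lt]; constructor <;> linarith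
    rw [← sub_div, sub_sub_sub_cancel_left, abs_div, abs_of_pos hδ, div_lt_one hδ] at this
    linarith

/-- Feng's finiteness theorem: if the sums with digits `-1, 0, 1` are separated from `0`, then only
finitely many of them lie in the centered interval of length `maxSum θ`. -/
theorem finite_allSums_inter_of_separated (h1 : 1 < θ) (h2 : θ < 2) {δ : ℝ} (hδ : 0 < δ)
    (hsep : ∀ t ∈ allSums {-1, 0, 1} θ, t ≠ 0 → δ ≤ |t|) :
    (allSums {-1, 0, 1} θ ∩ {t | |t| ≤ maxSum θ / 2}).Finite := by
  let S : Set ℕ := range fun p : ℕ × ℝ => (covering θ p.1 p.2).ncard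
  have hbdd : BddAbove S := ⟨_, by rintro _ ⟨p, rfl⟩; exact ncard_covering_le hδ hsep p.1 p.2⟩
  obtain ⟨⟨n, z⟩, hp⟩ := Nat.sSup_mem (range_nonempty _) hbdd
  have hmax : ∀ n' z', (covering θ n' z').ncard ≤ (covering θ n z).ncard := fun n' z' => by
    simp only at hp
    rw [hp]; exact le_csSup hbdd ⟨(n', z'), rfl⟩
  have hθ0 : 0 < θ := by linarith
  have hI2 := two_lt_maxSum h1 h2
  have hz : 0 ≤ z ∧ z ≤ θ ^ n * maxSum θ := by
    have h0 : (covering θ 0 0).Nonempty := ⟨0, rfl, by simp, by simp; linarith⟩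
    have : 0 < (covering θ n z).ncard :=
      ((ncard_pos (covering_finite 0 0)).2 h0).trans_le (hmax 0 0)
    obtain ⟨y, hy, hy0, hy1⟩ := (ncard_pos (covering_finite n z)).1 this
    have := nonneg_of_mem_levelSums hθ0.le hy
    have := le_of_mem_levelSums h1 hy
    constructor <;> linarith
  have hpow : 0 < θ ^ n := by positivity
  let T : Set ℝ := image2 (fun a b => (a - b) / θ ^ n) (levelSums {0, 1} θ n)
    (levelSums {0, 1} θ n)
  have hTneg : ∀ t, -t ∈ T → t ∈ T := by
    rintro t ⟨a, ha, b, hb, hab⟩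
    refine ⟨b, hb, a, ha, ?_⟩
    simp only at hab ⊢
    rw [← neg_sub a b, neg_div, hab, neg_neg]
  have key : ∀ t ∈ allSums {-1, 0, 1} θ, 0 ≤ θ ^ n * t + z → θ ^ n * t + z ≤ θ ^ n * maxSum θ →
      t ∈ T := by
    intro t ht h0 hle
    obtain ⟨m, hm⟩ := mem_allSums.1 ht
    obtain ⟨w, hw, v, hv, rfl⟩ := exists_sub_of_mem_levelSums hm
    obtain ⟨y, hy, hy0, hy1⟩ := covering_nonempty h1 h2 h0 hle
    -- Prefixing w maps the maximal covering into a covering with no more elements, hence onto it.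
    -- The sum with prefix v and tail y lies there too, so it also has the form θ^n w + a, and t =
    -- (y - a)/θ^n.
    have hsub : (fun a => θ ^ n * w + a) '' covering θ n z ⊆
        covering θ (m + n) (θ ^ n * w + z) := by
      rintro _ ⟨a, ⟨ha, ha0, ha1⟩, rfl⟩
      exact ⟨pow_mul_add_mem_levelSums hw ha, by simpa using ha0, by simpa using ha1⟩
    have heq := eq_of_subset_of_ncard_le hsub
      ((hmax _ _).trans_eq (ncard_image_of_injective _ (add_right_injective _)).symm)
      (covering_finite _ _)
    have hmem : θ ^ n * v + y ∈ covering θ (m + n) (θ ^ n * w + z) :=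
      ⟨pow_mul_add_mem_levelSums hv hy, by linarith, by linarith⟩
    rw [← heq] at hmem
    obtain ⟨a, ha, hay⟩ := hmem
    refine ⟨y, hy, a, ha.1, ?_⟩
    simp only at hay ⊢
    rw [div_eq_iff hpow.ne']
    linarith
  refine (Finite.image2 _ (levelSums_finite (toFinite _) n)
    (levelSums_finite (toFinite _) n) : T.Finite).subset ?_
  rintro t ⟨ht, habs⟩
  obtain ⟨hl, hr⟩ := abs_le.1 (show |t| ≤ maxSum θ / 2 from habs)
  -- If z is in the left half of [0, θ^n I], a shift to the right by at most half the length stays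
  -- inside; otherwise a shift to the left does. Hence t or -t is admissible.
  rcases le_total z (θ ^ n * (maxSum θ / 2)) with hz2 | hz2 <;> rcases le_total 0 t with h0 | h0
  · exact key t ht (by nlinarith) (by nlinarith)
  · exact hTneg t (key (-t) (neg_mem_allSums ht) (by nlinarith) (by nlinarith))
  · exact hTneg t (key (-t) (neg_mem_allSums ht) (by nlinarith) (by nlinarith))
  · exact key t ht (by nlinarith) (by nlinarith)

end

/-! ### Digit steps and integrality of the base -/

section down

/-- The digit step `x ↦ θ (x - 1)`; its fixed point is `θ / (θ - 1)`. -/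
def down {R : Type*} [Ring R] (θ x : R) : R := θ * (x - 1)

theorem down_mem_allSums {R : Type*} [Ring R] {θ x : R} (h : x ∈ allSums {-1, 0, 1} θ) :
    down θ x ∈ allSums {-1, 0, 1} θ := by
  simpa [down, sub_eq_add_neg] using step_mem_allSums h (a := -1) (by simp)

theorem iterate_down_mem_allSums {R : Type*} [Ring R] {θ x : R} (h : x ∈ allSums {-1, 0, 1} θ)
    (k : ℕ) : (down θ)^[k] x ∈ allSums {-1, 0, 1} θ := by
  induction k with
  | zero => exact h
  | succ k ih => rw [Function.iterate_succ_apply']; exact down_mem_allSums ih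

theorem iterate_down_eq {K : Type*} [Field K] {θ : K} (h : θ ≠ 1) (x : K) (k : ℕ) :
    (down θ)^[k] x = θ / (θ - 1) - θ ^ k * (θ / (θ - 1) - x) := by
  induction k with
  | zero => simp
  | succ k ih =>
    have : θ - 1 ≠ 0 := sub_ne_zero.2 h
    rw [Function.iterate_succ_apply', ih, down]
    field_simp
    ring

theorem iterate_down_prod {R S : Type*} [Ring R] [Ring S] (θ x : R × S) (k : ℕ) :
    (down θ)^[k] x = ((down θ.1)^[k] x.1, (down θ.2)^[k] x.2) := by
  induction k generalizing x with
  | zero => rfl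
  | succ k ih => rw [Function.iterate_succ_apply, ih]; rfl

end down

section

variable {θ : ℝ}

/-- Each step multiplies the distance to the fixed point `maxSum θ` by θ < 2, so this distance
cannot jump from below half of `maxSum θ` to `maxSum θ` or beyond. -/
theorem exists_iterate_down_mem (h1 : 1 < θ) (h2 : θ < 2) {t : ℝ} (h0 : 0 < t)
    (ht : t < maxSum θ) : ∃ k, 0 < (down θ)^[k] t ∧ (down θ)^[k] t ≤ maxSum θ / 2 := by
  have hex : ∃ k, maxSum θ / 2 ≤ θ ^ k * (maxSum θ - t) := by
    obtain ⟨k, hk⟩ := pow_unbounded_of_one_lt (maxSum θ / 2 / (maxSum θ - t)) h1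
    exact ⟨k, by rw [div_lt_iff₀ (by linarith)] at hk; exact hk.le⟩
  classical
  refine ⟨Nat.find hex, ?_⟩
  have hk := Nat.find_spec hex
  rw [iterate_down_eq h1.ne', ← maxSum]
  refine ⟨?_, by linarith⟩
  rcases hn : Nat.find hex with _ | n
  · simpa using h0
  · have := Nat.find_min hex (m := n) (by omega)
    rw [pow_succ']
    nlinarith [two_lt_maxSum h1 h2]

theorem exists_step_abs_le (h1 : 1 < θ) (h2 : θ < 2) {r t : ℝ} (hr : maxSum θ / 2 ≤ r)
    (hr' : r ≤ maxSum θ) (ht : |t| ≤ r) :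
    ∃ e ∈ ({-1, 0, 1} : Set ℤ), |θ * (t + e)| ≤ r := by
  have hI := mul_maxSum_sub_one h1
  have hI2 := lt_maxSum h1 h2
  obtain ⟨hl, hu⟩ := abs_le.1 ht
  by_cases ha : θ * t ≤ r
  · by_cases hb : -r ≤ θ * t
    · exact ⟨0, by simp, by rw [abs_le]; push_cast; constructor <;> linarith⟩
    · refine ⟨1, by simp, ?_⟩
      rw [abs_le]; push_cast; constructor <;> nlinarith
  · refine ⟨-1, by simp, ?_⟩
    rw [abs_le]; push_cast; constructor <;> nlinarith

-- Running the digit steps on polynomials, starting from X, gives monic polynomials of growing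
-- degree with values at θ in a finite set. The difference of two that agree at θ is monic and
-- vanishes there.
open Polynomial in
theorem isIntegral_of_separated (h1 : 1 < θ) (h2 : θ < 2) {δ : ℝ} (hδ : 0 < δ)
    (hsep : ∀ t ∈ allSums {-1, 0, 1} θ, t ≠ 0 → δ ≤ |t|) : IsIntegral ℤ θ := by
  have hfin := finite_allSums_inter_of_separated h1 h2 hδ hsep
  have hstep : ∀ (P : ℤ[X]) (a : ℤ), P.Monic → 0 < P.natDegree →
      (X * (P + C a)).Monic ∧ (X * (P + C a)).natDegree = P.natDegree + 1 := by
    intro P a hP hd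
    have hlt : (C a).degree < P.degree :=
      degree_C_le.trans_lt (natDegree_pos_iff_degree_pos.1 hd)
    refine ⟨monic_X.mul (hP.add_of_left hlt), ?_⟩
    rw [natDegree_X_mul (hP.add_of_left hlt).ne_zero, natDegree_add_C]
  have hstart : ∀ k : ℕ, ((down X)^[k] (X : ℤ[X])).Monic ∧
      ((down X)^[k] (X : ℤ[X])).natDegree = k + 1 ∧
      aeval θ ((down X)^[k] (X : ℤ[X])) = (down θ)^[k] θ := by
    intro k
    induction k with
    | zero => simp [monic_X]
    | succ k ih =>
      obtain ⟨hm, hd, he⟩ := ih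
      have := hstep _ (-1) hm (by omega)
      rw [Function.iterate_succ_apply', Function.iterate_succ_apply', ← he]
      have hdn : down X ((down X)^[k] (X : ℤ[X])) = X * ((down X)^[k] (X : ℤ[X]) + C (-1)) := by
        simp [down, sub_eq_add_neg]
      refine ⟨hdn ▸ this.1, by rw [hdn, this.2, hd], by simp [down]⟩
  have hθ : θ ∈ allSums {-1, 0, 1} θ := by
    simpa using step_mem_allSums (θ := θ) zero_mem_allSums (A := {-1, 0, 1}) (a := 1) (by simp)
  obtain ⟨k, hk0, hk⟩ := exists_iterate_down_mem h1 h2 (by linarith) (lt_maxSum h1 h2)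
  have hseq : ∀ n : ℕ, ∃ P : ℤ[X], P.Monic ∧ P.natDegree = k + 1 + n ∧
      aeval θ P ∈ allSums {-1, 0, 1} θ ∩ {t | |t| ≤ maxSum θ / 2} := by
    intro n
    induction n with
    | zero =>
      obtain ⟨hm, hd, he⟩ := hstart k
      refine ⟨_, hm, hd, ?_⟩
      rw [he]
      exact ⟨iterate_down_mem_allSums hθ k, by rwa [mem_ofPred, abs_of_pos hk0]⟩
    | succ n ih =>
      obtain ⟨P, hm, hd, hP, hP'⟩ := ih
      have hI := two_lt_maxSum h1 h2
      obtain ⟨e, he, hle⟩ := exists_step_abs_le h1 h2 le_rfl (by linarith) hP'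
      have := hstep P e hm (by omega)
      refine ⟨_, this.1, by rw [this.2, hd]; ring, ?_⟩
      have hev : aeval θ (X * (P + C e)) = θ * (aeval θ P + e) := by simp
      rw [hev]
      exact ⟨step_mem_allSums hP he, hle⟩
  choose P hm hd hP using hseq
  have hcol : ∃ i j, i < j ∧ aeval θ (P i) = aeval θ (P j) := by
    have := hfin.to_subtype
    obtain ⟨i, j, hne, hij⟩ := Finite.exists_ne_map_eq_of_infinite
      fun n => (⟨aeval θ (P n), hP n⟩ : (allSums {-1, 0, 1} θ ∩ {t | |t| ≤ maxSum θ / 2} : Set ℝ))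
    have hij := congrArg Subtype.val hij
    rcases hne.lt_or_gt with h | h
    exacts [⟨i, j, h, hij⟩, ⟨j, i, h, hij.symm⟩]
  obtain ⟨i, j, hlt, hij⟩ := hcol
  refine ⟨P j - P i, (hm j).sub_of_left (degree_lt_degree (by rw [hd, hd]; omega)), ?_⟩
  rw [← aeval_def, map_sub, hij, sub_self]

/-! ### Sums paired with their conjugates -/

/-- `p` is a complex Galois conjugate of `θ`: the same integer polynomials vanish at both. -/
def IsConjOf (θ : ℝ) (p : ℂ) : Prop :=
  ∀ P : Polynomial ℤ, Polynomial.aeval θ P = 0 ↔ Polynomial.aeval p P = 0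

open Polynomial in
theorem isConjOf_of_mem_aroots (h : IsIntegral ℤ θ) {p : ℂ}
    (hp : p ∈ (minpoly ℚ θ).aroots ℂ) : IsConjOf θ p := by
  have hQ : IsIntegral ℚ θ := h.tower_top
  have hp' : aeval p (minpoly ℚ θ) = 0 := ((mem_aroots).1 hp).2
  have hmin : minpoly ℚ θ = minpoly ℚ p :=
    minpoly.eq_of_irreducible_of_monic (minpoly.irreducible hQ) hp' (minpoly.monic hQ)
  intro P
  rw [← aeval_map_algebraMap ℚ θ P, ← aeval_map_algebraMap ℚ p P, ← minpoly.dvd_iff, hmin,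
    minpoly.dvd_iff]

variable {p : ℂ}

/-- The pairs `(∑ e_k θ^k, ∑ e_k p^k)` with digits `e_k ∈ {-1, 0, 1}`. -/
abbrev pairSums (θ : ℝ) (p : ℂ) : Set (ℝ × ℂ) := allSums {-1, 0, 1} ((θ, p) : ℝ × ℂ)

theorem fst_mem_allSums {x : ℝ × ℂ} (h : x ∈ pairSums θ p) : x.1 ∈ allSums {-1, 0, 1} θ := by
  obtain ⟨n, hn⟩ := mem_allSums.1 h
  exact mem_allSums.2 ⟨n, map_mem_levelSums (RingHom.fst ℝ ℂ) hn⟩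

theorem exists_mem_pairSums (p : ℂ) {t : ℝ} (h : t ∈ allSums {-1, 0, 1} θ) :
    ∃ u, (t, u) ∈ pairSums θ p := by
  obtain ⟨n, hn⟩ := mem_allSums.1 h
  obtain ⟨⟨t', u⟩, hy, rfl⟩ := exists_map_eq_of_mem_levelSums (θ := (θ, p)) (RingHom.fst ℝ ℂ) hn
  exact ⟨u, mem_allSums.2 ⟨n, hy⟩⟩

theorem step_mem_pairSums {t : ℝ} {u : ℂ} (h : (t, u) ∈ pairSums θ p) {e : ℤ}
    (he : e ∈ ({-1, 0, 1} : Set ℤ)) : (θ * (t + e), p * (u + e)) ∈ pairSums θ p :=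
  step_mem_allSums h he

theorem mul_mem_pairSums {t : ℝ} {u : ℂ} (h : (t, u) ∈ pairSums θ p) :
    (θ * t, p * u) ∈ pairSums θ p := by
  simpa using step_mem_pairSums h (e := 0) (by simp)

theorem down_mem_pairSums {t : ℝ} {u : ℂ} (h : (t, u) ∈ pairSums θ p) :
    (down θ t, down p u) ∈ pairSums θ p := down_mem_allSums h

theorem self_mem_pairSums : (θ, p) ∈ pairSums θ p := by
  simpa using step_mem_pairSums (θ := θ) (p := p) (t := 0) (u := 0) zero_mem_allSums
    (e := 1) (by simp)

theorem exists_aeval_eq_of_mem_pairSums {x : ℝ × ℂ} (hx : x ∈ pairSums θ p) :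
    ∃ P : Polynomial ℤ, Polynomial.aeval θ P = x.1 ∧ Polynomial.aeval p P = x.2 := by
  obtain ⟨n, hn⟩ := mem_allSums.1 hx
  induction n generalizing x with
  | zero => rw [mem_singleton_iff.1 hn]; exact ⟨0, map_zero _, map_zero _⟩
  | succ n ih =>
    obtain ⟨y, hy, a, -, rfl⟩ := hn
    obtain ⟨P, hP, hP'⟩ := ih (mem_allSums.2 ⟨n, hy⟩) hy
    exact ⟨Polynomial.X * (P + Polynomial.C a), by simp [hP], by simp [hP']⟩

theorem IsConjOf.unique (hp : IsConjOf θ p) {t : ℝ} {u v : ℂ} (hu : (t, u) ∈ pairSums θ p)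
    (hv : (t, v) ∈ pairSums θ p) : u = v := by
  obtain ⟨P, hP, hP'⟩ := exists_aeval_eq_of_mem_pairSums hu
  obtain ⟨Q, hQ, hQ'⟩ := exists_aeval_eq_of_mem_pairSums hv
  have := (hp (P - Q)).1 (by rw [map_sub, hP, hQ, sub_self])
  rw [map_sub, hP', hQ'] at this
  exact sub_eq_zero.1 this

theorem IsConjOf.eq_zero (hp : IsConjOf θ p) {u : ℂ} (hu : (0, u) ∈ pairSums θ p) : u = 0 :=
  hp.unique hu zero_mem_allSums

theorem IsConjOf.eq_zero_of_snd (hp : IsConjOf θ p) {t : ℝ} (ht : (t, 0) ∈ pairSums θ p) :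
    t = 0 := by
  obtain ⟨P, hP, hP'⟩ := exists_aeval_eq_of_mem_pairSums ht
  exact hP.symm.trans ((hp P).2 hP')

/-- If the sums are separated from `0`, the conjugates of bounded sums are bounded. -/
theorem IsConjOf.exists_norm_le (hp : IsConjOf θ p) (h1 : 1 < θ) (h2 : θ < 2) {δ : ℝ} (hδ : 0 < δ)
    (hsep : ∀ t ∈ allSums {-1, 0, 1} θ, t ≠ 0 → δ ≤ |t|) (hp1 : 1 ≤ ‖p‖) (hne : p ≠ 1) :
    ∃ C : ℝ, ∀ t u, (t, u) ∈ pairSums θ p → |t| ≤ maxSum θ → ‖u‖ ≤ C := by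
  -- The endpoint `maxSum θ` is added by hand: it is fixed by `down` and never enters the half
  -- interval.
  have hfin := (finite_allSums_inter_of_separated h1 h2 hδ hsep).union (finite_singleton (maxSum θ))
  have hG : {x ∈ pairSums θ p | |x.1| ≤ maxSum θ / 2 ∨ x.1 = maxSum θ}.Finite := by
    refine Finite.of_finite_image (f := Prod.fst) (hfin.subset ?_) ?_
    · rintro _ ⟨x, ⟨hx, hx'⟩, rfl⟩
      exact hx'.imp (fun h => ⟨fst_mem_allSums hx, h⟩) id
    · rintro ⟨t, u⟩ ⟨hu, -⟩ ⟨t', v⟩ ⟨hv, -⟩ (rfl : t = t')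
      rw [hp.unique hu hv]
  obtain ⟨C, hC⟩ := (hG.image fun x => ‖x.2‖).bddAbove
  have hC' : ∀ t u, (t, u) ∈ pairSums θ p → |t| ≤ maxSum θ / 2 ∨ t = maxSum θ → ‖u‖ ≤ C :=
    fun t u h h' => hC ⟨(t, u), ⟨h, h'⟩, rfl⟩
  have hI := two_lt_maxSum h1 h2
  have hC0 : 0 ≤ C := by
    simpa using hC' 0 0 zero_mem_allSums (Or.inl (by rw [abs_zero]; linarith))
  have hpos : ∀ t u, (t, u) ∈ pairSums θ p → 0 ≤ t → t ≤ maxSum θ →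
      ‖u‖ ≤ C + 2 * ‖p / (p - 1)‖ := by
    intro t u h h0 hle
    have hnn := norm_nonneg (p / (p - 1))
    rcases h0.eq_or_lt with rfl | h0
    · have := hC' _ _ h (Or.inl (by rw [abs_zero]; linarith)); linarith
    rcases hle.eq_or_lt with rfl | hlt
    · have := hC' _ _ h (Or.inr rfl); linarith
    obtain ⟨k, hk0, hk⟩ := exists_iterate_down_mem h1 h2 h0 hlt
    have hmem := iterate_down_mem_allSums h k
    rw [iterate_down_prod] at hmem
    have hb := hC' _ _ hmem (Or.inl (by rwa [abs_of_pos hk0]))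
    simp only at hb
    rw [iterate_down_eq hne] at hb
    -- As ‖p‖ ≥ 1, iterating `down` does not decrease the distance of the conjugate to its fixed
    -- point, so a bound after k steps gives one before.
    have e1 : ‖p / (p - 1) - u‖ ≤ ‖p ^ k * (p / (p - 1) - u)‖ := by
      rw [norm_mul, norm_pow]
      exact le_mul_of_one_le_left (norm_nonneg _) (one_le_pow₀ hp1)
    have e2 := norm_sub_norm_le (p ^ k * (p / (p - 1) - u)) (p / (p - 1))
    have e3 := norm_sub_norm_le u (p / (p - 1))
    rw [norm_sub_rev] at e2 e3
    linarith
  refine ⟨C + 2 * ‖p / (p - 1)‖, fun t u h ht => ?_⟩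
  obtain ⟨hl, hr⟩ := abs_le.1 ht
  rcases le_total 0 t with h0 | h0
  · exact hpos t u h h0 hr
  · rw [← norm_neg]
    exact hpos (-t) (-u) (neg_mem_allSums h) (by linarith) (by linarith)

end

/-! ### Greedy expansions and conjugates outside the closed unit disc -/

section greedy

/-- The leading greedy digit of `s`. -/
noncomputable def greedyDigit (s : ℝ) : ℤ := if s < 1 then 0 else 1

/-- The remainder `θ (s - d)` after removing the leading greedy digit `d` of `s`. -/
noncomputable def greedyRest (θ s : ℝ) : ℝ := θ * (s - greedyDigit s)

variable {θ : ℝ}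

theorem greedyDigit_eq (s : ℝ) : greedyDigit s = 0 ∨ greedyDigit s = 1 := by
  unfold greedyDigit; split_ifs <;> simp

theorem greedyRest_mem_Icc (h1 : 1 < θ) (h2 : θ < 2) {s : ℝ} (h : s ∈ Icc 0 (maxSum θ)) :
    greedyRest θ s ∈ Icc 0 (maxSum θ) := by
  have hI := mul_maxSum_sub_one h1
  have hI2 := lt_maxSum h1 h2
  obtain ⟨h0, hle⟩ := h
  unfold greedyRest greedyDigit
  split_ifs with hs <;> push_cast <;> constructor <;> nlinarith

theorem greedyRest_mem_Ico (h1 : 1 < θ) (h2 : θ < 2) {s : ℝ} (h : s ∈ Ico 0 (maxSum θ)) :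
    greedyRest θ s ∈ Ico 0 (maxSum θ) := by
  have hI := mul_maxSum_sub_one h1
  have hI2 := lt_maxSum h1 h2
  obtain ⟨h0, hle⟩ := h
  unfold greedyRest greedyDigit
  split_ifs with hs <;> push_cast <;> constructor <;> nlinarith

theorem iterate_greedyRest_mem_Icc (h1 : 1 < θ) (h2 : θ < 2) {s : ℝ} (h : s ∈ Icc 0 (maxSum θ))
    (n : ℕ) : (greedyRest θ)^[n] s ∈ Icc 0 (maxSum θ) :=
  (MapsTo.iterate (fun _ => greedyRest_mem_Icc h1 h2) n) h

theorem iterate_greedyRest_mem_Ico (h1 : 1 < θ) (h2 : θ < 2) {s : ℝ} (h : s ∈ Ico 0 (maxSum θ))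
    (n : ℕ) : (greedyRest θ)^[n] s ∈ Ico 0 (maxSum θ) :=
  (MapsTo.iterate (fun _ => greedyRest_mem_Ico h1 h2) n) h

end greedy

section expanding

variable {θ : ℝ} {p : ℂ}

/-- The greedy expansion of `x` in base `θ`, evaluated in base `p`. -/
noncomputable def greedyEval (θ : ℝ) (p : ℂ) (x : ℝ) : ℂ :=
  ∑' i, (greedyDigit ((greedyRest θ)^[i] x) : ℂ) * p⁻¹ ^ i

theorem norm_greedyDigit_mul_le (x : ℝ) (i : ℕ) :
    ‖(greedyDigit ((greedyRest θ)^[i] x) : ℂ) * p⁻¹ ^ i‖ ≤ ‖p‖⁻¹ ^ i := by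
  rw [norm_mul, norm_pow, norm_inv]
  refine mul_le_of_le_one_left (by positivity) ?_
  rcases greedyDigit_eq ((greedyRest θ)^[i] x) with h | h <;> simp [h]

theorem summable_greedyEval (hp1 : 1 < ‖p‖) (x : ℝ) :
    Summable fun i => (greedyDigit ((greedyRest θ)^[i] x) : ℂ) * p⁻¹ ^ i :=
  Summable.of_norm_bounded
    (summable_geometric_of_lt_one (by positivity) (inv_lt_one_of_one_lt₀ hp1))
    (norm_greedyDigit_mul_le x)

theorem norm_greedyEval_le (hp1 : 1 < ‖p‖) (x : ℝ) :
    ‖greedyEval θ p x‖ ≤ (1 - ‖p‖⁻¹)⁻¹ :=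
  tsum_of_norm_bounded
    (hasSum_geometric_of_lt_one (by positivity) (inv_lt_one_of_one_lt₀ hp1))
    (norm_greedyDigit_mul_le x)

/-- Two greedy digits differ by -1, 0 or 1, so the difference of the remainders stays among the
sums; v is its conjugate. -/
theorem exists_pair_greedyRest_sub (hp0 : p ≠ 0) {t : ℝ} {u : ℂ} (h : (t, u) ∈ pairSums θ p) (x : ℝ)
    (n : ℕ) : ∃ v, ((greedyRest θ)^[n] (x + t) - (greedyRest θ)^[n] x, v) ∈ pairSums θ p ∧
      u = ∑ i ∈ Finset.range n, ((greedyDigit ((greedyRest θ)^[i] (x + t)) : ℂ) * p⁻¹ ^ i -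
        (greedyDigit ((greedyRest θ)^[i] x) : ℂ) * p⁻¹ ^ i) + p⁻¹ ^ n * v := by
  induction n with
  | zero => exact ⟨u, by simpa using h, by simp⟩
  | succ n ih =>
    obtain ⟨v, hv, hu⟩ := ih
    have he : greedyDigit ((greedyRest θ)^[n] x) - greedyDigit ((greedyRest θ)^[n] (x + t)) ∈
        ({-1, 0, 1} : Set ℤ) := by
      rcases greedyDigit_eq ((greedyRest θ)^[n] x) with h | h <;>
      rcases greedyDigit_eq ((greedyRest θ)^[n] (x + t)) with h' | h' <;> simp [h, h']
    refine ⟨p * (v + (greedyDigit ((greedyRest θ)^[n] x) -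
      greedyDigit ((greedyRest θ)^[n] (x + t)) : ℤ)), ?_, ?_⟩
    · convert step_mem_pairSums hv he using 2
      rw [Function.iterate_succ_apply', Function.iterate_succ_apply', greedyRest, greedyRest]
      push_cast
      ring
    · rw [Finset.sum_range_succ, hu, pow_succ]
      push_cast
      field_simp
      ring

/-- Differences of greedy remainders stay in [-I, I], so their conjugates stay bounded and the error
term p⁻ⁿ v tends to 0. -/
theorem IsConjOf.greedyEval_add (hp : IsConjOf θ p) (h1 : 1 < θ) (h2 : θ < 2) {δ : ℝ} (hδ : 0 < δ)
    (hsep : ∀ t ∈ allSums {-1, 0, 1} θ, t ≠ 0 → δ ≤ |t|) (hp1 : 1 < ‖p‖) {t : ℝ} {u : ℂ}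
    (h : (t, u) ∈ pairSums θ p) {x : ℝ} (hx : x ∈ Ico 0 (maxSum θ))
    (hxt : x + t ∈ Ico 0 (maxSum θ)) : greedyEval θ p (x + t) = greedyEval θ p x + u := by
  have hne : p ≠ 1 := by rintro rfl; simp at hp1
  have hp0 : p ≠ 0 := by rintro rfl; simp at hp1; linarith
  obtain ⟨C, hC⟩ := hp.exists_norm_le h1 h2 hδ hsep hp1.le hne
  choose v hv hu using exists_pair_greedyRest_sub hp0 h x
  have hvC : ∀ n, ‖v n‖ ≤ C := fun n => hC _ _ (hv n) (by
    have e1 := iterate_greedyRest_mem_Ico h1 h2 hx n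
    have e2 := iterate_greedyRest_mem_Ico h1 h2 hxt n
    rw [abs_le]; constructor <;> linarith [e1.1, e1.2, e2.1, e2.2])
  have hlim : Tendsto (fun n => p⁻¹ ^ n * v n) atTop (𝓝 0) := by
    refine squeeze_zero_norm (a := fun n => ‖p‖⁻¹ ^ n * C) (fun n => ?_) ?_
    · rw [norm_mul, norm_pow, norm_inv]; gcongr; exact hvC n
    · simpa using (tendsto_pow_atTop_nhds_zero_of_lt_one (by positivity)
        (inv_lt_one_of_one_lt₀ hp1)).mul_const C
  have hs := ((summable_greedyEval (θ := θ) hp1 (x + t)).hasSum.sub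
    (summable_greedyEval (θ := θ) hp1 x).hasSum).tendsto_sum_nat.add hlim
  have := tendsto_nhds_unique hs (tendsto_const_nhds.congr hu)
  rw [add_zero] at this
  rw [← this, greedyEval, greedyEval]
  ring

/-- Two commensurate translations of a long interval force the conjugates to be proportional. -/
theorem IsConjOf.mul_eq_mul (hp : IsConjOf θ p) (h1 : 1 < θ) (h2 : θ < 2) {δ : ℝ} (hδ : 0 < δ)
    (hsep : ∀ t ∈ allSums {-1, 0, 1} θ, t ≠ 0 → δ ≤ |t|) (hp1 : 1 < ‖p‖) {s t : ℝ} {u v : ℂ}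
    (hs : (s, u) ∈ pairSums θ p) (ht : (t, v) ∈ pairSums θ p) (hs0 : 0 < s) (ht0 : 0 < t)
    (hst : s + t ≤ maxSum θ) : u * t = v * s := by
  let g := greedyEval θ p
  have hg : ∀ {t : ℝ} {u : ℂ}, (t, u) ∈ pairSums θ p → ∀ {x : ℝ}, x ∈ Ico 0 (maxSum θ) →
      x + t ∈ Ico 0 (maxSum θ) → g (x + t) = g x + u :=
    fun h _ hx hxt => hp.greedyEval_add h1 h2 hδ hsep hp1 h hx hxt
  have hI2 := two_lt_maxSum h1 h2
  -- From a point of [0, I), step by s if this stays below I and by -t otherwise; `s + t ≤ maxSum θ`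
  -- keeps the second move nonnegative.
  have orbit : ∀ k : ℕ, ∃ m n : ℕ, m + n = k ∧ (m * s - n * t : ℝ) ∈ Ico 0 (maxSum θ) ∧
      g (m * s - n * t) = g 0 + (m * u - n * v) := by
    intro k
    induction k with
    | zero => exact ⟨0, 0, rfl, ⟨by simp, by simp; linarith⟩, by simp⟩
    | succ k ih =>
      obtain ⟨m, n, hk, hx, hgx⟩ := ih
      rcases lt_or_ge (m * s - n * t + s : ℝ) (maxSum θ) with hlt | hge
      · have hy : (m * s - n * t + s : ℝ) ∈ Ico 0 (maxSum θ) := ⟨by linarith [hx.1], hlt⟩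
        have e : ((m + 1 : ℕ) * s - n * t : ℝ) = m * s - n * t + s := by push_cast; ring
        refine ⟨m + 1, n, by omega, e ▸ hy, ?_⟩
        rw [e, hg hs hx hy, hgx]; push_cast; ring
      · have hy : (m * s - n * t + -t : ℝ) ∈ Ico 0 (maxSum θ) :=
          ⟨by linarith, by linarith [hx.2]⟩
        have e : (m * s - (n + 1 : ℕ) * t : ℝ) = m * s - n * t + -t := by push_cast; ring
        refine ⟨m, n + 1, by omega, e ▸ hy, ?_⟩
        rw [e, hg (neg_mem_allSums ht) hx hy, hgx]; push_cast; ring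
  obtain ⟨B, hB⟩ : ∃ B, ∀ x, ‖g x‖ ≤ B := ⟨_, norm_greedyEval_le hp1⟩
  by_contra hne
  have hpos : 0 < ‖u * t - v * s‖ := norm_pos_iff.2 (sub_ne_zero.2 hne)
  let D := (s + t) * (2 * B) + (‖u‖ + ‖v‖) * maxSum θ
  obtain ⟨k, hk⟩ := exists_nat_gt (D / ‖u * t - v * s‖)
  rw [div_lt_iff₀ hpos] at hk
  obtain ⟨m, n, hmn, hx, hgx⟩ := orbit k
  refine hk.not_ge ?_
  have e1 : ‖(m * u - n * v : ℂ)‖ ≤ 2 * B := by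
    rw [← sub_eq_iff_eq_add'.2 hgx]
    linarith [norm_sub_le (g (m * s - n * t)) (g 0), hB (m * s - n * t), hB 0]
  have e2 : ‖((m * s - n * t : ℝ) : ℂ)‖ ≤ maxSum θ := by
    rw [Complex.norm_real, Real.norm_eq_abs, abs_of_nonneg hx.1]; exact hx.2.le
  -- Both ms - nt and mu - nv are bounded, so this identity bounds k‖ut - vs‖ uniformly in k.
  have e3 : (k : ℂ) * (u * t - v * s) =
      ((s + t : ℝ) : ℂ) * (m * u - n * v) - (u + v) * ((m * s - n * t : ℝ) : ℂ) := by
    rw [← hmn]; push_cast; ring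
  calc (k : ℝ) * ‖u * t - v * s‖ = ‖(k : ℂ) * (u * t - v * s)‖ := by
        rw [norm_mul, Complex.norm_natCast]
    _ ≤ ‖((s + t : ℝ) : ℂ)‖ * ‖(m * u - n * v : ℂ)‖ +
        ‖u + v‖ * ‖((m * s - n * t : ℝ) : ℂ)‖ := by
        rw [e3, ← norm_mul, ← norm_mul]; exact norm_sub_le _ _
    _ ≤ D := by
        have : ‖((s + t : ℝ) : ℂ)‖ = s + t := by
          rw [Complex.norm_real, Real.norm_eq_abs, abs_of_pos (by linarith)]
        rw [this]
        have := norm_add_le u v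
        have := norm_nonneg (u + v)
        simp only [D]
        gcongr

theorem IsConjOf.eq_one_of_one_lt_norm (hp : IsConjOf θ p) (h1 : 1 < θ) (h2 : θ < 2) {δ : ℝ}
    (hδ : 0 < δ) (hsep : ∀ t ∈ allSums {-1, 0, 1} θ, t ≠ 0 → δ ≤ |t|) (hp1 : 1 < ‖p‖)
    (hpθ : p ≠ θ) {t : ℝ} (ht : t ∈ allSums {-1, 0, 1} θ) (ht0 : 0 < t)
    (hle : t ≤ maxSum θ / 2) : t = 1 := by
  have hI := mul_maxSum_sub_one h1
  have hIθ := lt_maxSum h1 h2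
  obtain ⟨u, hu⟩ := exists_mem_pairSums p ht
  have hne0 : ∀ {s v}, (s, v) ∈ pairSums θ p → 0 < s → v ≠ 0 := by
    rintro s v hs hs0 rfl
    exact hs0.ne' (hp.eq_zero_of_snd hs)
  have hsub : p - θ ≠ 0 := sub_ne_zero.2 hpθ
  have hprop : ∀ {s v}, (s, v) ∈ pairSums θ p → |s| ≤ maxSum θ - t → v * t = u * s := by
    intro s v hs hsle
    obtain ⟨hl, hr⟩ := abs_le.1 hsle
    rcases lt_trichotomy s 0 with h | rfl | h
    · have := hp.mul_eq_mul h1 h2 hδ hsep hp1 (neg_mem_allSums hs) hu (by simpa using h) ht0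
        (by linarith)
      push_cast at this
      linear_combination -this
    · rw [hp.eq_zero hs]; simp
    · exact hp.mul_eq_mul h1 h2 hδ hsep hp1 hs hu h ht0 (by linarith)
  have ht0' : (t : ℂ) ≠ 0 := by exact_mod_cast ht0.ne'
  -- Otherwise s and θs, with conjugates v and pv, have the same ratio, forcing p = θ.
  have hbig : ∀ {s v}, (s, v) ∈ pairSums θ p → 0 < s → s ≤ maxSum θ - t →
      maxSum θ - t < θ * s := by
    intro s v hs hs0 hsle
    by_contra! hcon
    have e1 := hprop hs (by rwa [abs_of_pos hs0])
    have e2 := hprop (mul_mem_pairSums hs) (by rwa [abs_of_pos (by positivity)])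
    push_cast at e2
    have : (p - θ) * (v * t) = 0 := by linear_combination e2 - θ * e1
    exact mul_ne_zero hsub (mul_ne_zero (hne0 hs hs0) ht0') this
  have hdown : ∀ {s v}, (s, v) ∈ pairSums θ p → 0 < s → s ≤ maxSum θ - t →
      |down θ s| ≤ maxSum θ - t := by
    intro s v hs hs0 hsle
    have := hbig hs hs0 hsle
    rw [down, abs_le]
    constructor <;> nlinarith
  -- Proportionality at both s and `down θ s` is a linear equation for s with nonzero coefficient
  -- u(p - θ), so it determines s.
  have hrel : ∀ {s v}, (s, v) ∈ pairSums θ p → 0 < s → s ≤ maxSum θ - t →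
      u * s * (p - θ) = p * t - u * θ := by
    intro s v hs hs0 hsle
    have e1 := hprop hs (by rwa [abs_of_pos hs0])
    have e2 := hprop (down_mem_pairSums hs) (hdown hs hs0 hsle)
    simp only [down] at e2
    push_cast at e2
    linear_combination e2 - p * e1
  have huniq : ∀ {s v}, (s, v) ∈ pairSums θ p → 0 < s → s ≤ maxSum θ - t → s = t := by
    intro s v hs hs0 hsle
    have : u * (p - θ) * (s - t) = 0 := by
      linear_combination hrel hs hs0 hsle - hrel hu ht0 (by linarith)
    have := (mul_eq_zero.1 this).resolve_left (mul_ne_zero (hne0 hu ht0) hsub)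
    exact_mod_cast sub_eq_zero.1 this
  have hd := hdown hu ht0 (by linarith)
  obtain ⟨hl, hr⟩ := abs_le.1 hd
  -- By uniqueness `down θ t` is -t, 0 or t. The first gives t + θt = θ < I, so t and θt would be
  -- proportional to their conjugates; the last gives t = I.
  rcases lt_trichotomy (down θ t) 0 with h | h | h
  · exfalso
    have e : -down θ t = t := huniq (neg_mem_allSums (down_mem_pairSums hu))
      (by simpa using h) (by linarith)
    rw [down] at e
    have := hp.mul_eq_mul h1 h2 hδ hsep hp1 hu (mul_mem_pairSums hu) ht0 (by positivity)
      (by linarith)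
    push_cast at this
    have h0 : (p - θ) * (u * t) = 0 := by linear_combination -this
    exact mul_ne_zero hsub (mul_ne_zero (hne0 hu ht0) ht0') h0
  · rw [down, mul_eq_zero] at h
    rcases h with h | h <;> linarith
  · exfalso
    have e : down θ t = t := huniq (down_mem_pairSums hu) h hr
    rw [down] at e
    nlinarith

end expanding

/-! ### The exceptional equation x^m (2 - x) = 1 -/

section multinacci

/-- Divided by the m-th power, the geometric sum becomes x⁻¹ + ... + x⁻ᵐ, which decreases in x. -/
theorem geom_sum_mul_pow_lt {r q : ℝ} (hr : 0 < r) (hrq : r < q) {m : ℕ} (hm : m ≠ 0) :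
    (∑ i ∈ Finset.range m, q ^ i) * r ^ m < (∑ i ∈ Finset.range m, r ^ i) * q ^ m := by
  rw [Finset.sum_mul, Finset.sum_mul]
  have hle : ∀ i ∈ Finset.range m, q ^ i * r ^ m ≤ r ^ i * q ^ m := by
    intro i hi
    obtain ⟨j, rfl⟩ := Nat.exists_eq_add_of_lt (Finset.mem_range.1 hi)
    rw [add_assoc, pow_add r i, pow_add q i]
    have := pow_le_pow_left₀ hr.le hrq.le (j + 1)
    have h1 : 0 < r ^ i := by positivity
    have h2 : 0 < q ^ i := by have := hr.trans hrq; positivity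
    nlinarith [mul_le_mul_of_nonneg_left this (mul_pos h1 h2).le]
  refine Finset.sum_lt_sum hle ⟨0, Finset.mem_range.2 (Nat.pos_of_ne_zero hm), ?_⟩
  simpa using pow_lt_pow_left₀ hrq hr.le hm

theorem eq_norm_of_norm_two_sub {p : ℂ} (h : ‖2 - p‖ = 2 - ‖p‖) : p = ‖p‖ := by
  have e1 : ‖2 - p‖ ^ 2 = (2 - p.re) ^ 2 + p.im ^ 2 := by
    rw [Complex.sq_norm, Complex.normSq_apply]; simp; ring
  have e2 : ‖p‖ ^ 2 = p.re ^ 2 + p.im ^ 2 := by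
    rw [Complex.sq_norm, Complex.normSq_apply]; ring
  rw [h] at e1
  have hre : p.re = ‖p‖ := by nlinarith
  have him : p.im = 0 := by rw [← hre] at e2; nlinarith
  exact Complex.ext (by simpa using hre) (by simpa using him)

/-- The roots of `x ^ m (2 - x) = 1` other than `1` and the root in `(1, 2)` lie in the open unit
disc. -/
theorem norm_lt_one_of_pow_mul_two_sub {θ : ℝ} {p : ℂ} (h1 : 1 < θ) (h2 : θ < 2) {m : ℕ}
    (hm : m ≠ 0) (hθ : θ ^ m * (2 - θ) = 1) (hp : p ^ m * (2 - p) = 1) (hp1 : p ≠ 1)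
    (hpθ : p ≠ θ) : ‖p‖ < 1 := by
  by_contra! hge
  have hn : ‖p‖ ^ m * ‖2 - p‖ = 1 := by rw [← norm_pow, ← norm_mul, hp, norm_one]
  have hgθ : ∑ i ∈ Finset.range m, θ ^ i = θ ^ m := by
    have := geom_sum_mul θ m
    have h0 : θ - 1 ≠ 0 := by linarith
    refine mul_right_cancel₀ h0 ?_
    rw [this]; linarith
  have hgp : ∑ i ∈ Finset.range m, p ^ i = p ^ m := by
    have := geom_sum_mul p m
    refine mul_right_cancel₀ (sub_ne_zero.2 hp1) ?_
    rw [this]; linear_combination hp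
  have hrev : 2 - ‖p‖ ≤ ‖2 - p‖ := by simpa using norm_sub_norm_le (2 : ℂ) p
  rcases hge.eq_or_lt with he | hlt
  · refine hp1 ?_
    rw [← he, one_pow, one_mul] at hn
    rw [eq_norm_of_norm_two_sub (p := p) (by rw [← he]; linarith), ← he, Complex.ofReal_one]
  -- Comparison with θ: a smaller modulus contradicts ‖2 - p‖ ≥ 2 - ‖p‖, a larger one contradicts
  -- the triangle inequality in p^m = ∑ p^i, and equality makes p a positive real.
  rcases lt_trichotomy ‖p‖ θ with h | h | h
  · have e1 := geom_sum_mul_pow_lt (by linarith) h hm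
    rw [hgθ, mul_comm] at e1
    have e2 : ‖p‖ ^ m < ∑ i ∈ Finset.range m, ‖p‖ ^ i :=
      lt_of_mul_lt_mul_right e1 (by positivity)
    have e3 := geom_sum_mul ‖p‖ m
    have : 0 < ‖p‖ ^ m := by positivity
    nlinarith
  · refine hpθ ?_
    rw [eq_norm_of_norm_two_sub (p := p) ?_, h]
    rw [h, ← mul_right_inj' (pow_ne_zero m (zero_lt_one.trans h1).ne'), hθ, ← h, hn]
  · have e1 := geom_sum_mul_pow_lt (by linarith) h hm
    rw [hgθ] at e1
    have e2 : ‖p‖ ^ m ≤ ∑ i ∈ Finset.range m, ‖p‖ ^ i := by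
      rw [← norm_pow, ← hgp]
      exact (norm_sum_le _ _).trans_eq (Finset.sum_congr rfl fun i _ => norm_pow _ _)
    have : 0 < θ ^ m := by positivity
    nlinarith

/-- Some `down` iterate of θ lies in (0, I/2], so it equals 1, and the same iterate of p is then 1.
Both identities read x^(k+1) (2 - x) = 1. -/
theorem IsConjOf.norm_lt_one_of_forall_eq_one {θ : ℝ} {p : ℂ} (hp : IsConjOf θ p) (h1 : 1 < θ)
    (h2 : θ < 2) (hp0 : p ≠ 0) (hp1 : p ≠ 1) (hpθ : p ≠ θ)
    (hall : ∀ t ∈ allSums {-1, 0, 1} θ, 0 < t → t ≤ maxSum θ / 2 → t = 1) : ‖p‖ < 1 := by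
  obtain ⟨k, hk0, hk⟩ := exists_iterate_down_mem h1 h2 (by linarith) (lt_maxSum h1 h2)
  have hmem := iterate_down_mem_allSums (self_mem_pairSums (θ := θ) (p := p)) k
  rw [iterate_down_prod] at hmem
  have hθk := hall _ (fst_mem_allSums hmem) hk0 hk
  simp only at hθk hmem
  rw [hθk] at hmem
  have hpk : (down p)^[k] p = 1 := by
    have := hp.unique (mul_mem_pairSums hmem) (by rw [mul_one]; exact self_mem_pairSums)
    exact mul_left_cancel₀ hp0 (by rw [this, mul_one])
  rw [iterate_down_eq h1.ne'] at hθk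
  rw [iterate_down_eq hp1] at hpk
  have hθ1 : θ - 1 ≠ 0 := by linarith
  have hp1' : p - 1 ≠ 0 := sub_ne_zero.2 hp1
  field_simp at hθk hpk
  refine norm_lt_one_of_pow_mul_two_sub h1 h2 k.succ_ne_zero ?_ ?_ hp1 hpθ
  · rw [pow_succ]; linear_combination -hθk
  · rw [pow_succ]; linear_combination -hpk

end multinacci

/-! ### Bounded digit paths with prescribed signs -/

section paths

variable {θ : ℝ}

theorem hasSum_inv_pow (h1 : 1 < θ) : HasSum (fun n : ℕ => θ⁻¹ ^ n) (maxSum θ) := by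
  have h0 : θ - 1 ≠ 0 := by linarith
  have : maxSum θ = (1 - θ⁻¹)⁻¹ := by
    have : θ ≠ 0 := by linarith
    rw [maxSum]; field_simp
  rw [this]
  exact hasSum_geometric_of_lt_one (by positivity) (inv_lt_one_of_one_lt₀ h1)

open Classical in
/-- The sum of `θ⁻¹ ^ n` over all `n` in `S`. -/
noncomputable def weight (θ : ℝ) (S : ℕ → Prop) : ℝ := ∑' n, if S n then θ⁻¹ ^ n else 0

open Classical in
theorem summable_weight (h1 : 1 < θ) (S : ℕ → Prop) :
    Summable fun n => if S n then θ⁻¹ ^ n else 0 := by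
  have h0 : 0 < θ := by linarith
  refine (hasSum_inv_pow h1).summable.of_nonneg_of_le (fun n => ?_) fun n => ?_
  · split_ifs <;> positivity
  · split_ifs
    exacts [le_rfl, by positivity]

theorem weight_nonneg (h1 : 1 < θ) (S : ℕ → Prop) : 0 ≤ weight θ S := by
  have h0 : 0 < θ := by linarith
  exact tsum_nonneg fun n => by split_ifs <;> positivity

theorem weight_mono (h1 : 1 < θ) {S T : ℕ → Prop} (h : ∀ n, S n → T n) :
    weight θ S ≤ weight θ T := by
  have h0 : 0 < θ := by linarith
  refine (summable_weight h1 S).tsum_le_tsum (fun n => ?_) (summable_weight h1 T)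
  by_cases hn : S n
  · simp [hn, h n hn]
  · simp only [hn, if_false]; split_ifs <;> positivity

theorem weight_add_weight_not (h1 : 1 < θ) (S : ℕ → Prop) :
    weight θ S + weight θ (fun n => ¬ S n) = maxSum θ := by
  rw [weight, weight, ← (summable_weight h1 S).tsum_add (summable_weight h1 fun n => ¬ S n),
    ← (hasSum_inv_pow h1).tsum_eq]
  congr 1
  ext n
  by_cases h : S n <;> simp [h]

theorem weight_le (h1 : 1 < θ) (S : ℕ → Prop) : weight θ S ≤ maxSum θ := by
  linarith [weight_add_weight_not h1 S, weight_nonneg h1 fun n => ¬ S n]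

open Classical in
theorem weight_succ (h1 : 1 < θ) (S : ℕ → Prop) :
    weight θ (fun n => S (n + 1)) = θ * (weight θ S - if S 0 then 1 else 0) := by
  have h0 : θ ≠ 0 := by linarith
  rw [weight, weight, (summable_weight h1 S).tsum_eq_zero_add, pow_zero, add_sub_cancel_left,
    ← tsum_mul_left]
  congr 1
  ext n
  split_ifs
  · rw [pow_succ]; field_simp
  · simp

/-- A bounded state can be kept bounded forever with digits whose signs are prescribed, provided the
prescribed positive digits do not carry too much weight. -/
theorem exists_signed_path (h1 : 1 < θ) (h2 : θ < 2) (S : ℕ → Prop) {t : ℝ} (ht : 0 ≤ t)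
    (hle : t + weight θ S ≤ maxSum θ) : ∃ (s : ℕ → ℝ) (e : ℕ → ℤ), s 0 = t ∧
      (∀ n, s (n + 1) = θ * (s n + e n)) ∧ (∀ n, |s n| ≤ maxSum θ) ∧
      ∀ n, (S n → e n = 0 ∨ e n = 1) ∧ (¬ S n → e n = 0 ∨ e n = -1) := by
  classical
  -- The digits e are the indicator of S minus the greedy digits of x; the state is the greedy
  -- remainder minus the remaining weight of S.
  let x := t + weight θ S
  have hx : x ∈ Icc 0 (maxSum θ) := ⟨by have := weight_nonneg h1 S; positivity, hle⟩
  refine ⟨fun n => (greedyRest θ)^[n] x - weight θ fun i => S (i + n),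
    fun n => (if S n then 1 else 0) - greedyDigit ((greedyRest θ)^[n] x), by simp [x], ?_, ?_, ?_⟩
  · intro n
    have := weight_succ h1 fun i => S (i + n)
    simp only [add_right_comm _ 1 n, zero_add] at this
    simp only [Function.iterate_succ_apply', ← add_assoc]
    rw [this, greedyRest]
    split_ifs <;> push_cast <;> ring
  · intro n
    have e1 := iterate_greedyRest_mem_Icc h1 h2 hx n
    have e2 := weight_nonneg h1 fun i => S (i + n)
    have e3 := weight_le h1 fun i => S (i + n)
    rw [abs_le]
    constructor <;> linarith [e1.1, e1.2]
  · intro n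
    rcases greedyDigit_eq ((greedyRest θ)^[n] x) with h | h <;> by_cases hS : S n <;> simp [h, hS]

theorem eq_pow_mul_of_path_zero {s : ℕ → ℝ} {e : ℕ → ℤ}
    (hs : ∀ n, s (n + 1) = θ * (s n + e n)) {n L : ℕ}
    (he : ∀ i, n ≤ i → i < n + L → e i = 0) : s (n + L) = θ ^ L * s n := by
  induction L with
  | zero => simp
  | succ L ih =>
    rw [← add_assoc, hs, ih fun i hi hi' => he i hi (by omega), he _ (by omega) (by omega), pow_succ]
    push_cast
    ring

/-- If the gains `e n * Re (ω r ^ n)` of a bounded path are summable, with `r` an irrational rotation,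
then the path reaches `0`. -/
theorem exists_path_eq_zero (h1 : 1 < θ) {δ : ℝ} (hδ : 0 < δ) {s : ℕ → ℝ} {e : ℕ → ℤ}
    (hs : ∀ n, s (n + 1) = θ * (s n + e n)) (hle : ∀ n, |s n| ≤ maxSum θ)
    (hsep : ∀ n, s n ≠ 0 → δ ≤ |s n|) {ω r : ℂ} (hω : ‖ω‖ = 1) (hr : ‖r‖ = 1)
    (hr' : ∀ k : ℕ, k ≠ 0 → (r ^ k).im ≠ 0)
    (hsum : Summable fun n => (e n : ℝ) * (ω * r ^ n).re) : ∃ n, s n = 0 := by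
  by_contra! hne
  obtain ⟨L, hL⟩ : ∃ L, maxSum θ < θ ^ L * δ := by
    obtain ⟨L, hL⟩ := pow_unbounded_of_one_lt (maxSum θ / δ) h1
    exact ⟨L, by rwa [div_lt_iff₀ hδ] at hL⟩
  -- L zero digits in a row would multiply a state of size at least δ by θ^L and push it beyond
  -- `maxSum θ`.
  have hex : ∀ n, ∃ i, n ≤ i ∧ i < n + L ∧ e i ≠ 0 := by
    intro n
    by_contra! hcon
    have := hle (n + L)
    have hpos : 0 < θ ^ L := by positivity
    rw [eq_pow_mul_of_path_zero hs hcon, abs_mul, abs_of_pos hpos] at this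
    have := mul_le_mul_of_nonneg_left (hsep n (hne n)) hpos.le
    linarith
  -- Distances up to L suffice; L + 1 keeps the interval nonempty when L = 0.
  obtain ⟨k₀, hk₀, hmin⟩ := (Finset.Icc 1 (L + 1)).exists_min_image (fun k => |(r ^ k).im|)
    ⟨1, by simp⟩
  set η := |(r ^ k₀).im| with hη
  have hη0 : 0 < η := abs_pos.2 (hr' k₀ (by have := (Finset.mem_Icc.1 hk₀).1; omega))
  -- With η/4, two nearby nonzero digits give |Im z| ≥ 1 - η/4 and |Im z|·|Im r^k| ≤ η/2, which is
  -- impossible for η ≤ 1 and |Im r^k| ≥ η.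
  obtain ⟨N, hN⟩ := Metric.tendsto_atTop.1 hsum.tendsto_atTop_zero (η / 4) (by positivity)
  have hsmall : ∀ i, N ≤ i → e i ≠ 0 → |(ω * r ^ i).re| < η / 4 := by
    intro i hi hei
    have := hN i hi
    rw [Real.dist_0_eq_abs, abs_mul] at this
    have h1 : (1 : ℝ) ≤ |(e i : ℝ)| := by exact_mod_cast Int.one_le_abs hei
    nlinarith [abs_nonneg (ω * r ^ i).re]
  obtain ⟨i, hi, -, hei⟩ := hex N
  obtain ⟨j, hj, hjL, hej⟩ := hex (i + 1)
  obtain ⟨k, rfl⟩ := Nat.exists_eq_add_of_le (show i ≤ j by omega)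
  have hk := hmin k (Finset.mem_Icc.2 ⟨by omega, by omega⟩)
  have c1 := hsmall i hi hei
  have c2 := hsmall (i + k) (by omega) hej
  rw [pow_add, ← mul_assoc, Complex.mul_re] at c2
  set z := ω * r ^ i with hz
  have hzn : ‖z‖ = 1 := by rw [hz, norm_mul, norm_pow, hω, hr]; simp
  have hrn : ‖r ^ k‖ = 1 := by rw [norm_pow, hr, one_pow]
  have a1 := Complex.norm_le_abs_re_add_abs_im z
  have a2 := Complex.abs_re_le_norm (r ^ k)
  have a3 : η ≤ 1 := by
    rw [hη]; exact (Complex.abs_im_le_norm _).trans_eq (by rw [norm_pow, hr, one_pow])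
  rw [hzn] at a1
  rw [hrn] at a2
  have a4 : |z.im| * |(r ^ k).im| ≤ |z.re * (r ^ k).re - z.im * (r ^ k).im| +
      |z.re| * |(r ^ k).re| := by
    rw [← abs_mul, ← abs_mul]
    have := abs_sub_abs_le_abs_sub (z.im * (r ^ k).im) (z.re * (r ^ k).re)
    rw [abs_sub_comm] at this
    linarith
  nlinarith [abs_nonneg z.re, abs_nonneg z.im, abs_nonneg (r ^ k).re,
    mul_le_mul_of_nonneg_left a2 (abs_nonneg z.re), mul_le_mul_of_nonneg_left hk (abs_nonneg z.im)]

end paths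

/-! ### Conjugates on the unit circle -/

section unimodular

variable {θ : ℝ} {p : ℂ}

/-- Some partial sum already exceeds a, and its finitely many strict inequalities persist nearby. -/
theorem isOpen_weight_re_neg (h1 : 1 < θ) (r : ℂ) (a : ℝ) :
    IsOpen {ω : ℂ | a < weight θ fun n => (ω * r ^ n).re < 0} := by
  classical
  have h0 : 0 < θ := by linarith
  rw [isOpen_iff_mem_nhds]
  intro ω hω
  obtain ⟨m, hm⟩ := ((summable_weight h1 _).hasSum.tendsto_sum_nat.eventually
    (lt_mem_nhds (show a < weight θ fun n => (ω * r ^ n).re < 0 from hω))).exists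
  have hev : ∀ᶠ ω' in 𝓝 ω, ∀ i ∈ Finset.range m, (ω * r ^ i).re < 0 → (ω' * r ^ i).re < 0 := by
    rw [Finset.eventually_all]
    intro i _
    by_cases hi : (ω * r ^ i).re < 0
    · have hc : Continuous fun ω' : ℂ => (ω' * r ^ i).re := by fun_prop
      filter_upwards [hc.continuousAt.eventually (gt_mem_nhds hi)] with ω' h _ using h
    · exact Eventually.of_forall fun _ h => absurd h hi
  filter_upwards [hev] with ω' h'
  refine hm.trans_le ((Finset.sum_le_sum fun i hi => ?_).trans
    ((summable_weight h1 fun n => (ω' * r ^ n).re < 0).sum_le_tsum (Finset.range m)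
      fun i _ => by split_ifs <;> positivity))
  by_cases hc : (ω * r ^ i).re < 0
  · rw [if_pos hc, if_pos (h' i hi hc)]
  · simp only [hc, if_false]; split_ifs <;> positivity

/-- Some half plane through the origin cuts the sequence `r ^ n` into two parts of balanced
weights. -/
theorem exists_balanced (h1 : 1 < θ) (r : ℂ) : ∃ ω : ℂ, ‖ω‖ = 1 ∧
    (weight θ fun n => (ω * r ^ n).re < 0) ≤ maxSum θ / 2 ∧
    (weight θ fun n => (-ω * r ^ n).re < 0) ≤ maxSum θ / 2 := by
  by_contra! hcon
  let U := {ω : ℂ | maxSum θ / 2 < weight θ fun n => (ω * r ^ n).re < 0}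
  have hU : IsOpen U := isOpen_weight_re_neg h1 r _
  have hV : IsOpen (-U) := hU.neg
  have hsub : Metric.sphere (0 : ℂ) 1 ⊆ U ∪ -U := by
    intro ω hω
    rw [mem_sphere_zero_iff_norm] at hω
    by_cases h : ω ∈ U
    · exact Or.inl h
    · exact Or.inr (hcon ω hω (not_lt.1 h))
  have hne : (Metric.sphere (0 : ℂ) 1 ∩ U).Nonempty ∧ (Metric.sphere (0 : ℂ) 1 ∩ -U).Nonempty := by
    rcases hsub (show (1 : ℂ) ∈ Metric.sphere (0 : ℂ) 1 by simp) with h | h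
    · exact ⟨⟨1, by simp, h⟩, ⟨-1, by simp, by simpa using h⟩⟩
    · exact ⟨⟨-1, by simp, h⟩, ⟨1, by simp, h⟩⟩
  -- Connectedness of the circle makes U and -U meet, but two opposite open half planes cannot both
  -- carry more than half of the total weight.
  obtain ⟨ω, -, hω, hω'⟩ := (isPreconnected_sphere (by simp [Complex.rank_real_complex]) (0 : ℂ) 1)
    U (-U) hU hV hsub hne.1 hne.2
  have hω : maxSum θ / 2 < weight θ fun n => (ω * r ^ n).re < 0 := hω
  have hω' : maxSum θ / 2 < weight θ fun n => (-ω * r ^ n).re < 0 := hω'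
  have := weight_mono h1 (S := fun n => (-ω * r ^ n).re < 0)
    (T := fun n => ¬ (ω * r ^ n).re < 0) fun n hn => by
      rw [neg_mul, Complex.neg_re] at hn; linarith
  linarith [weight_add_weight_not h1 fun n => (ω * r ^ n).re < 0]

/-- A real power would be ±1, making p, and hence its conjugate θ > 1, a root of unity. -/
theorem IsConjOf.pow_im_ne_zero (hp : IsConjOf θ p) (h1 : 1 < θ) (hp1 : ‖p‖ = 1) {k : ℕ}
    (hk : k ≠ 0) : (p⁻¹ ^ k).im ≠ 0 := by
  intro him
  have hn : ‖p⁻¹ ^ k‖ = 1 := by rw [norm_pow, norm_inv, hp1]; simp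
  have hsq : (p⁻¹ ^ k) ^ 2 = 1 := by
    have hre : p⁻¹ ^ k = ((p⁻¹ ^ k).re : ℂ) := Complex.ext rfl him
    rw [hre, Complex.norm_real, Real.norm_eq_abs] at hn
    rw [hre, ← Complex.ofReal_pow, ← sq_abs, hn, one_pow, Complex.ofReal_one]
  rw [← pow_mul, inv_pow, inv_eq_one] at hsq
  have := (hp (Polynomial.X ^ (k * 2) - 1)).2 (by simp [hsq])
  simp only [map_sub, map_pow, Polynomial.aeval_X, map_one] at this
  have := one_lt_pow₀ h1 (n := k * 2) (by omega)
  linarith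

/-- Digits are signed so that each moves the conjugate forward in direction ω. Since the conjugates
stay bounded, the gains are summable, so the path reaches 0; the conjugate then vanishes too, and
both coordinates have finite expansions. -/
theorem IsConjOf.exists_finite_expansion (hp : IsConjOf θ p) (h1 : 1 < θ) (h2 : θ < 2) {δ : ℝ}
    (hδ : 0 < δ) (hsep : ∀ t ∈ allSums {-1, 0, 1} θ, t ≠ 0 → δ ≤ |t|) (hp1 : ‖p‖ = 1) {ω : ℂ}
    (hω : ‖ω‖ = 1) {t : ℝ} {u : ℂ} (h : (t, u) ∈ pairSums θ p) (ht0 : 0 ≤ t)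
    (hle : t + (weight θ fun n => 0 < (ω * p⁻¹ ^ n).re) ≤ maxSum θ) :
    ∃ (n : ℕ) (e : ℕ → ℤ), (∀ i, e i ∈ ({-1, 0, 1} : Set ℤ)) ∧
      (∀ i, 0 ≤ (e i : ℝ) * (ω * p⁻¹ ^ i).re) ∧
      t = -∑ i ∈ Finset.range n, (e i : ℝ) * θ⁻¹ ^ i ∧
      (ω * u).re = -∑ i ∈ Finset.range n, (e i : ℝ) * (ω * p⁻¹ ^ i).re := by
  have hθ0 : θ ≠ 0 := by linarith
  have hp0 : p ≠ 0 := by rintro rfl; simp at hp1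
  have hpne : p ≠ 1 := by
    rintro rfl
    exact hp.pow_im_ne_zero h1 hp1 one_ne_zero (by simp)
  obtain ⟨C, hC⟩ := hp.exists_norm_le h1 h2 hδ hsep hp1.ge hpne
  obtain ⟨s, e, hs0, hs, hsle, he⟩ :=
    exists_signed_path h1 h2 (fun n => 0 < (ω * p⁻¹ ^ n).re) ht0 hle
  have hemem : ∀ i, e i ∈ ({-1, 0, 1} : Set ℤ) := by
    intro i
    by_cases hi : 0 < (ω * p⁻¹ ^ i).re
    · rcases (he i).1 hi with h | h <;> simp [h]
    · rcases (he i).2 hi with h | h <;> simp [h]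
  have hgain : ∀ i, 0 ≤ (e i : ℝ) * (ω * p⁻¹ ^ i).re := by
    intro i
    by_cases hi : 0 < (ω * p⁻¹ ^ i).re
    · rcases (he i).1 hi with h | h
      · simp [h]
      · rw [h, Int.cast_one, one_mul]; exact hi.le
    · rcases (he i).2 hi with h | h
      · simp [h]
      · rw [h]; push_cast; linarith
  have hpair : ∀ n, (s n, p ^ n * (u + ∑ i ∈ Finset.range n, (e i : ℂ) * p⁻¹ ^ i)) ∈
      pairSums θ p := by
    intro n
    induction n with
    | zero => simpa [hs0] using h
    | succ n ih =>
      convert step_mem_pairSums ih (hemem n) using 2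
      · exact hs n
      · rw [Finset.sum_range_succ, pow_succ, inv_pow]; field_simp; ring
  have hsum : ∀ n, s n = θ ^ n * (t + ∑ i ∈ Finset.range n, (e i : ℝ) * θ⁻¹ ^ i) := by
    intro n
    induction n with
    | zero => simpa using hs0
    | succ n ih => rw [hs, ih, Finset.sum_range_succ, pow_succ, inv_pow]; field_simp; ring
  have hre : ∀ n, (ω * (u + ∑ i ∈ Finset.range n, (e i : ℂ) * p⁻¹ ^ i)).re =
      (ω * u).re + ∑ i ∈ Finset.range n, (e i : ℝ) * (ω * p⁻¹ ^ i).re := by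
    intro n
    rw [mul_add, Complex.add_re, Finset.mul_sum, Complex.re_sum]
    congr 1
    refine Finset.sum_congr rfl fun i _ => ?_
    rw [mul_left_comm, ← Complex.ofReal_intCast, Complex.re_ofReal_mul]
  have hbound : ∀ n, ∑ i ∈ Finset.range n, (e i : ℝ) * (ω * p⁻¹ ^ i).re ≤ 2 * C := by
    intro n
    have b1 := hC _ _ (hpair n) (hsle n)
    have b2 := hC _ _ h (by rw [← hs0]; exact hsle 0)
    rw [norm_mul, norm_pow, hp1, one_pow, one_mul] at b1
    have b3 := Complex.re_le_norm (ω * (u + ∑ i ∈ Finset.range n, (e i : ℂ) * p⁻¹ ^ i))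
    have b4 := Complex.abs_re_le_norm (ω * u)
    rw [norm_mul, hω, one_mul] at b3 b4
    have := (abs_le.1 b4).1
    rw [hre] at b3
    linarith
  obtain ⟨n, hn⟩ := exists_path_eq_zero h1 hδ hs hsle
    (fun n => hsep _ (fst_mem_allSums (hpair n))) hω (by rw [norm_inv, hp1, inv_one])
    (fun k hk => hp.pow_im_ne_zero h1 hp1 hk) (summable_of_sum_range_le hgain hbound)
  refine ⟨n, e, hemem, hgain, ?_, ?_⟩
  · have := hsum n
    rw [hn, eq_comm, mul_eq_zero] at this
    linarith [this.resolve_left (pow_ne_zero n hθ0)]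
  · have h0 := hpair n
    rw [hn] at h0
    have := (mul_eq_zero.1 (hp.eq_zero h0)).resolve_left (pow_ne_zero n hp0)
    have h' := hre n
    rw [this, mul_zero, Complex.zero_re] at h'
    linarith

theorem IsConjOf.eq_one_of_norm_eq_one (hp : IsConjOf θ p) (h1 : 1 < θ) (h2 : θ < 2) {δ : ℝ}
    (hδ : 0 < δ) (hsep : ∀ t ∈ allSums {-1, 0, 1} θ, t ≠ 0 → δ ≤ |t|) (hp1 : ‖p‖ = 1)
    {t : ℝ} (ht : t ∈ allSums {-1, 0, 1} θ) (ht0 : 0 < t) (hle : t ≤ maxSum θ / 2) : t = 1 := by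
  have hθ0 : 0 < θ := by linarith
  have hI := two_lt_maxSum h1 h2
  obtain ⟨ω, hω, hw, hw'⟩ := exists_balanced h1 p⁻¹
  have hunique : ∀ i j : ℕ, i < j → (ω * p⁻¹ ^ i).re = 0 → (ω * p⁻¹ ^ j).re ≠ 0 := by
    intro i j hij hi hj
    obtain ⟨k, rfl⟩ := Nat.exists_eq_add_of_le hij.le
    rw [pow_add, ← mul_assoc, Complex.mul_re, hi, zero_mul, zero_sub, neg_eq_zero,
      mul_eq_zero] at hj
    have him := hj.resolve_right (hp.pow_im_ne_zero h1 hp1 (by omega))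
    have hz : ω * p⁻¹ ^ i = 0 := Complex.ext hi him
    have := congrArg norm hz
    rw [norm_mul, norm_pow, norm_inv, hω, hp1] at this
    simp at this
  have key : ∀ t ∈ allSums {-1, 0, 1} θ, 0 < t → t ≤ maxSum θ / 2 →
      ∃ i : ℕ, (ω * p⁻¹ ^ i).re = 0 ∧ t = θ⁻¹ ^ i := by
    intro t ht ht0 hle
    obtain ⟨u, hu⟩ := exists_mem_pairSums p ht
    obtain ⟨n, e, he, hgain, hsum, hre⟩ := hp.exists_finite_expansion h1 h2 hδ hsep hp1 hω hu
      ht0.le (by simp only [neg_mul, Complex.neg_re, neg_lt_zero] at hw'; linarith)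
    obtain ⟨n', e', -, hgain', -, hre'⟩ := hp.exists_finite_expansion h1 h2 hδ hsep hp1
      (ω := -ω) (by rwa [norm_neg]) hu ht0.le
      (by simp only [neg_mul, Complex.neg_re, neg_pos]; linarith)
    have hs := Finset.sum_nonneg fun i (_ : i ∈ Finset.range n) => hgain i
    have hs' := Finset.sum_nonneg fun i (_ : i ∈ Finset.range n') => hgain' i
    have hre'' : -(ω * u).re = (-ω * u).re := by simp
    -- The directions ω and -ω bound Re(ωu) by 0 from above and below, so every gain vanishes; by
    -- `hunique` only one digit can then be nonzero.
    have hzero : ∑ i ∈ Finset.range n, (e i : ℝ) * (ω * p⁻¹ ^ i).re = 0 := by linarith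
    have hall := (Finset.sum_eq_zero_iff_of_nonneg fun i _ => hgain i).1 hzero
    obtain ⟨i, hi, hei⟩ : ∃ i ∈ Finset.range n, e i ≠ 0 := by
      by_contra! hcon
      rw [Finset.sum_eq_zero fun i hi => by rw [hcon i hi]; simp] at hsum
      linarith
    have hroot : ∀ j ∈ Finset.range n, e j ≠ 0 → (ω * p⁻¹ ^ j).re = 0 := fun j hj hej =>
      (mul_eq_zero.1 (hall j hj)).resolve_left (by exact_mod_cast hej)
    refine ⟨i, hroot i hi hei, ?_⟩
    rw [Finset.sum_eq_single_of_mem i hi fun j hj hji => ?_] at hsum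
    · have hpos : 0 < θ⁻¹ ^ i := by positivity
      rcases he i with h | h | h
      · rw [hsum, h]; simp
      · exact absurd h hei
      · rw [h] at hsum; push_cast at hsum; linarith
    · by_cases hej : e j = 0
      · simp [hej]
      · exfalso
        rcases hji.lt_or_gt with h | h
        · exact hunique j i h (hroot j hj hej) (hroot i hi hei)
        · exact hunique i j h (hroot i hi hei) (hroot j hj hej)
  obtain ⟨i, hi, rfl⟩ := key t ht ht0 hle
  rcases i with _ | i
  · simp
  · exfalso
    -- If the exponent were positive, θt would be a sum in (0, I/2] as well and yield a second index
    -- with vanishing real part.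
    have hmul : θ * θ⁻¹ ^ (i + 1) = θ⁻¹ ^ i := by rw [pow_succ]; field_simp
    have hmem : θ⁻¹ ^ i ∈ allSums {-1, 0, 1} θ := by
      have := step_mem_allSums ht (a := 0) (by simp)
      rwa [Int.cast_zero, add_zero, hmul] at this
    have hle1 : θ⁻¹ ^ i ≤ 1 := pow_le_one₀ (by positivity) (inv_le_one_of_one_le₀ h1.le)
    obtain ⟨j, hj, hij⟩ := key _ hmem (by positivity) (by linarith)
    have : i = j := by
      refine pow_right_injective₀ (by positivity) (inv_lt_one_of_one_lt₀ h1).ne hij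
    subst this
    exact hunique i (i + 1) (by omega) hj hi

end unimodular

/-! ### Conclusion -/

/-- If the sums with digits `-1, 0, 1` are separated from `0`, then the base is a Pisot number. -/
theorem isPisot_of_separated {θ : ℝ} (h1 : 1 < θ) (h2 : θ < 2) {δ : ℝ} (hδ : 0 < δ)
    (hsep : ∀ t ∈ allSums {-1, 0, 1} θ, t ≠ 0 → δ ≤ |t|) : IsPisot θ := by
  have hint := isIntegral_of_separated h1 h2 hδ hsep
  refine ⟨h1, hint, fun p hp hpθ => ?_⟩
  have hconj := isConjOf_of_mem_aroots hint hp
  by_contra! hge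
  have hp0 : p ≠ 0 := by rintro rfl; simp at hge; linarith
  have hp1 : p ≠ 1 := by
    rintro rfl
    have := (hconj (Polynomial.X - 1)).2 (by simp)
    simp at this
    linarith
  refine hge.not_gt (hconj.norm_lt_one_of_forall_eq_one h1 h2 hp0 hp1 hpθ fun t ht ht0 hle => ?_)
  rcases hge.eq_or_lt with h | h
  · exact hconj.eq_one_of_norm_eq_one h1 h2 hδ hsep h.symm ht ht0 hle
  · exact hconj.eq_one_of_one_lt_norm h1 h2 hδ hsep h hpθ ht ht0 hle

theorem gapLiminf_pos_iff_isPisot {θ : ℝ} (h1 : 1 < θ) (h2 : θ < 2) {A : Set ℤ} (hA : {0, 1} ⊆ A)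
    {m : ℝ} (hm : ∀ a ∈ A, ∀ b ∈ A, |((a - b : ℤ) : ℝ)| ≤ m) :
    0 < gapLiminf (digitSums A θ) ↔ IsPisot θ := by
  have h0 : (0 : ℤ) ∈ A := hA (by simp)
  rw [digitSums_eq_allSums h0]
  constructor
  · intro h
    obtain ⟨δ, hδ, hsep⟩ := exists_le_abs_of_gapLiminf_pos h1 hA h
    exact isPisot_of_separated h1 h2 hδ hsep
  · exact fun h => h.gapLiminf_pos h0 hm

theorem mainTheorem4 (θ : ℝ) (h1 : 1 < θ) (h2 : θ < 2) :
    (∃ y : ℕ → ℝ, StrictMono y ∧ Set.range y = digitSums {0, 1} θ ∧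
      (0 < Filter.liminf (fun n => ((y (n + 1) - y n : ℝ) : EReal)) Filter.atTop ↔ IsPisot θ)) ∧
    (0 < gapLiminf (digitSums {-1, 0, 1} θ) ↔ IsPisot θ) := by
  constructor
  · obtain ⟨y, hy, hrange, hlim⟩ := exists_strictMono_range_eq (X := allSums {0, 1} θ)
      ⟨0, zero_mem_allSums⟩ (allSums_inter_Iic_finite h1) fun M => by
        obtain ⟨k, hk⟩ := pow_unbounded_of_one_lt M h1
        exact ⟨_, mem_allSums.2 ⟨_, pow_mem_levelSums Subset.rfl k⟩,
          hk.trans_le (pow_le_pow_right₀ h1.le k.le_succ)⟩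
    rw [← digitSums_eq_allSums (by simp)] at hrange
    refine ⟨y, hy, hrange, ?_⟩
    rw [← gapLiminf_range y hy hlim, hrange]
    refine gapLiminf_pos_iff_isPisot h1 h2 Subset.rfl (m := 1) ?_
    rintro a (rfl | rfl) b (rfl | rfl) <;> norm_num
  · refine gapLiminf_pos_iff_isPisot h1 h2 (fun a ha => Or.inr ha) (m := 2) ?_
    rintro a (rfl | rfl | rfl) b (rfl | rfl | rfl) <;> norm_num
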